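/- Let $\nu>-1$ and $\theta>1$ be real. For $k\ge 0$ let $$L_k^{\nu}(x)=\sum_{i=0}^{k}(-1)^i\binom{k+\nu}{k-i}\frac{x^i}{i!},\qquad \mathbb{L}_k^{\nu}=\Big(\frac{k!}{\Gamma(k+\nu+1)}\Big)^{1/2}L_k^{\nu}$$ be the Laguerre polynomials and the orthonormal Laguerre polynomials with respect to the weight $x^{\nu}e^{-x}$ on $\mathbf{R}^+=(0,\infty)$. For $f\in L^2(\mathbf{R}^+,x^{\nu}e^{-x}dx)$ (complex-valued) put $$f_k=\int_0^\infty f(x)\,\mathbb{L}_k^{\nu}(x)\,x^{\nu}e^{-x}\,dx .$$ Let $K_\nu(x)=\int_0^\infty e^{-x\cosh t}\cosh(\nu t)\,dt$, $x>0$, be the Macdonald function (modified Bessel function of the second kind), and let $d\sigma$ be Lebesgue area measure on $\mathbb{C}$. Then for every function $f:\mathbf{R}^+\to\mathbb{C}$ the following are equivalent: (a) $f\in L^2(\mathbf{R}^+,x^{\nu}e^{-x}dx)$ and $\displaystyle\sum_{k=0}^\infty |f_k|^2\theta^k<\infty$; (b) there is an entire function $F$ such that $f(x)=F(x)$ for almost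 every $x\in\mathbf{R}^+$ and $$\int_{\mathbb{C}}|F(z)|^2\exp\Big(\frac{2\Re z}{\theta-1}\Big)|z|^{\nu}K_\nu\Big(\frac{2\sqrt{\theta}\,|z|}{\theta-1}\Big)\,d\sigma(z)<\infty .$$ -/

import Mathlib

open MeasureTheory Set

noncomputable section

/-- The Laguerre weight `x ^ ν * e ^ (-x)`, used for `x > 0`. -/
def laguerreWeight (ν x : ℝ) : ℝ := x ^ ν * Real.exp (-x)

/-- The measure `x ^ ν * e ^ (-x) dx` on the positive half-line. -/
def laguerreMeasure (ν : ℝ) : Measure ℝ :=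
  (volume.restrict (Ioi (0 : ℝ))).withDensity fun x => ENNReal.ofReal (laguerreWeight ν x)

/-- The standardly normalized (generalized) Laguerre polynomial, as a function on `ℝ`:
`L_k^ν (x) = ∑_{i ≤ k} (-1)^i * binom (k + ν) (k - i) * x^i / i!`, where
`binom (k + ν) (k - i) = Γ(k + ν + 1) / (Γ(ν + i + 1) * (k - i)!)`. -/
def laguerreL (ν : ℝ) (k : ℕ) (x : ℝ) : ℝ :=
  ∑ i ∈ Finset.range (k + 1),
    (-1) ^ i * (Real.Gamma (k + ν + 1) / (Real.Gamma (ν + i + 1) * (Nat.factorial (k - i) : ℝ))) *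
      (x ^ i / (Nat.factorial i : ℝ))

/-- The Laguerre polynomial normalized to have norm one in `L²(x ^ ν * e ^ (-x) dx)`. -/
def laguerreON (ν : ℝ) (k : ℕ) (x : ℝ) : ℝ :=
  Real.sqrt ((Nat.factorial k : ℝ) / Real.Gamma (k + ν + 1)) * laguerreL ν k x

/-- The `k`-th Fourier–Laguerre coefficient
`f_k = ∫_0^∞ f(x) 𝕃_k^ν(x) x^ν e^{-x} dx`. -/
def laguerreCoeff (ν : ℝ) (f : ℝ → ℂ) (k : ℕ) : ℂ :=
  ∫ x in Ioi (0 : ℝ), f x * (laguerreON ν k x : ℂ) * (laguerreWeight ν x : ℂ)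

/-- The Macdonald function (modified Bessel function of the second kind) of real order `ν`,
for `x > 0`: `K_ν(x) = ∫_0^∞ e^{-x cosh t} cosh(ν t) dt`. -/
def macdonaldK (ν x : ℝ) : ℝ :=
  ∫ t in Ioi (0 : ℝ), Real.exp (-x * Real.cosh t) * Real.cosh (ν * t)

end

/-!
A function `f` in `L²(x ^ ν * e ^ (-x) dx)` with `∑ |f_k|² θ ^ k < ∞` is compared with an entire
function `F` through the Hilbert space `ℓ²`.

The weight in the area integral is radial after the factor `|exp (z / (θ - 1))|²` has been absorbed
into `|F z|²`. Writing `exp (z / (θ - 1)) * F z = ∑ h_n z ^ n`, polar coordinates and Parseval's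
identity on circles turn the area integral into `∑ 2π |h_n|² m_n`, where `m_n` is a moment of the
Macdonald function, a constant times `((θ - 1)² / θ) ^ n * n! * Γ(n + ν + 1)`
(`lintegral_norm_sq_mul_rpow_mul_macdonaldK`). Hence `F` has a finite weighted integral exactly when
`exp (z / (θ - 1)) * F z = ⟪fockKernel z, u⟫` for some `u` in `ℓ²`, the normalized coefficient
sequence of the power series (`integrable_iff_exists_inner_fockKernel`).

The normalized coefficient sequence of `exp (z / (θ - 1)) * L_k(z)` is a Meixner polynomial
`n ↦ M_k(n)` times the square root of the negative binomial weight
(`inner_fockKernel_eq_laguerreON`). Meixner polynomials are orthogonal for that weight, the squared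
norm of the sequence belonging to the orthonormal `𝕃_k` being a constant times `θ ^ k`. They are
moreover self-dual, `M_k(n) = M_n(k)`, so the matrix of normalized sequences is symmetric with
orthonormal columns; such a matrix is unitary, and its columns are a Hilbert basis of `ℓ²`
(`exists_hilbertBasis_of_symmetric_of_orthonormal`). Expanding `u` in this basis gives the pointwise
expansion of `F` in Laguerre polynomials, with coefficients `f_k` for which `∑ |f_k|² θ ^ k < ∞`
(`hasSum_inner_mul_laguerreON`).

On the half-line, the `𝕃_k` are a Hilbert basis of `L²(x ^ ν * e ^ (-x) dx)`
(`exists_hilbertBasis_laguerreLp`); completeness is the determinacy of the moment problem for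
measures with exponential moments. The two expansions are matched because an `L²` limit and a
pointwise limit of the same partial sums agree almost everywhere (`ae_eq_of_hasSum_laguerre`).
-/

open scoped InnerProductSpace lp ComplexConjugate

lemma HasSum.of_eq {ι α : Type*} [AddCommMonoid α] [TopologicalSpace α] {f g : ι → α} {a b : α}
    (h : HasSum f a) (hfg : ∀ i, g i = f i) (hab : b = a) : HasSum g b := by
  rwa [hab, funext hfg]

/-! ### Rising factorials and alternating binomial sums -/

lemma Gamma_add_nat_eq_ascPochhammer {s : ℝ} (hs : 0 < s) (j : ℕ) :
    Real.Gamma (s + j) = (ascPochhammer ℝ j).eval s * Real.Gamma s := by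
  induction j with
  | zero => simp
  | succ j ih =>
    have h : s + j ≠ 0 := by positivity
    rw [ascPochhammer_succ_right]
    push_cast
    rw [← add_assoc, Real.Gamma_add_one h, ih]
    simp
    ring

/-- The `k`-th finite difference of the rising factorial of length `j ≤ k`; this sum is what
makes both the Laguerre and the Meixner polynomials orthogonal. -/
lemma sum_neg_one_pow_choose_mul_ascPochhammer (β : ℝ) {j k : ℕ} (hjk : j ≤ k) :
    ∑ i ∈ Finset.range (k + 1), (-1 : ℝ) ^ i * k.choose i * (ascPochhammer ℝ j).eval (β + i) =
      if j = k then (-1) ^ k * (k.factorial : ℝ) else 0 := by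
  have hfd := fwdDiff_iter_eq_sum_shift (1 : ℝ) (ascPochhammer ℝ j).eval k β
  have hsum : ∑ i ∈ Finset.range (k + 1),
      (-1 : ℝ) ^ i * k.choose i * (ascPochhammer ℝ j).eval (β + i) =
      (-1) ^ k * (fwdDiff 1)^[k] (ascPochhammer ℝ j).eval β := by
    rw [hfd, Finset.mul_sum]
    refine Finset.sum_congr rfl fun i hi => ?_
    have hik : i ≤ k := Nat.lt_succ_iff.mp (Finset.mem_range.mp hi)
    have hsign : (-1 : ℝ) ^ k * (-1) ^ (k - i) = (-1) ^ i := by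
      rw [← pow_add, show k + (k - i) = 2 * (k - i) + i by omega, pow_add, pow_mul]
      simp
    simp only [zsmul_eq_mul, nsmul_eq_mul, mul_one]
    push_cast
    rw [← hsign]
    ring
  rw [hsum]
  rcases hjk.eq_or_lt with rfl | hlt
  · have h := Polynomial.fwdDiff_iter_degree_eq_factorial (ascPochhammer ℝ j)
    rw [ascPochhammer_natDegree] at h
    simp [h, (monic_ascPochhammer ℝ j).leadingCoeff]
  · have h := Polynomial.fwdDiff_iter_eq_zero_of_degree_lt (P := ascPochhammer ℝ j) (n := k)
      (by rwa [ascPochhammer_natDegree])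
    simp [h, hlt.ne]

/-! ### Meixner polynomials -/

/-- The negative binomial series. -/
lemma hasSum_Gamma_add_nat_div_factorial {s q : ℝ} (hs : 0 < s) (hq0 : 0 ≤ q) (hq1 : q < 1) :
    HasSum (fun n : ℕ => Real.Gamma (s + n) / n.factorial * q ^ n)
      (Real.Gamma s * (1 - q) ^ (-s)) := by
  have h := (Real.one_div_one_sub_rpow_hasFPowerSeriesOnBall_zero s).hasSum (y := q)
    (by simp [enorm_eq_nnnorm, ← NNReal.coe_lt_coe, abs_of_nonneg hq0, hq1])
  simp only [zero_add, FormalMultilinearSeries.ofScalars_apply_eq] at h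
  refine (h.mul_left (Real.Gamma s)).of_eq (fun n => ?_) ?_
  · have hc : (n.factorial : ℝ) * Ring.choose (s + n - 1) n = (ascPochhammer ℝ n).eval s := by
      rw [Ring.choose, ← nsmul_eq_mul, Ring.factorial_nsmul_multichoose_eq_ascPochhammer,
        ← Polynomial.aeval_eq_smeval]
      simp [Polynomial.aeval_def, Polynomial.eval₂_eq_eval_map,
        show s + n - 1 - n + 1 = s by ring]
    have hn : (n.factorial : ℝ) ≠ 0 := by positivity
    rw [Gamma_add_nat_eq_ascPochhammer hs, ← hc]
    simp only [smul_eq_mul]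
    field_simp
  · rw [Real.rpow_neg (by linarith), one_div]

/-- The Meixner weight `Γ(n + β) / n! * θ⁻ⁿ` on the natural numbers. -/
noncomputable def meixnerWeight (β θ : ℝ) (n : ℕ) : ℝ :=
  Real.Gamma (β + n) / n.factorial * θ⁻¹ ^ n

/-- The Meixner polynomial of degree `k` at the integer `n`, divided by `Γ(β)`: this is the
hypergeometric sum `₂F₁(-n, -k; β; 1 - θ) / Γ(β)`. -/
noncomputable def meixner (β θ : ℝ) (n k : ℕ) : ℝ :=
  ∑ i ∈ Finset.range (k + 1),
    (n.choose i : ℝ) * k.choose i * (i.factorial / Real.Gamma (β + i)) * (1 - θ) ^ i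

lemma meixnerWeight_pos {β θ : ℝ} (hβ : 0 < β) (hθ : 0 < θ) (n : ℕ) :
    0 < meixnerWeight β θ n := by
  have := Real.Gamma_pos_of_pos (show 0 < β + n by positivity)
  unfold meixnerWeight
  positivity

lemma meixner_comm (β θ : ℝ) (n k : ℕ) : meixner β θ n k = meixner β θ k n := by
  have key : ∀ n k : ℕ, meixner β θ n k = ∑ i ∈ Finset.range (n + k + 1),
      (n.choose i : ℝ) * k.choose i * (i.factorial / Real.Gamma (β + i)) * (1 - θ) ^ i := by
    intro n k
    refine Finset.sum_subset (fun i hi => ?_) fun i _ hi => ?_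
    · simp only [Finset.mem_range] at hi ⊢
      omega
    · rw [Nat.choose_eq_zero_of_lt (by simpa [Nat.lt_succ_iff] using hi : k < i)]
      simp
  rw [key, key, add_comm n k]
  exact Finset.sum_congr rfl fun i _ => by ring

/-- Moments of the Meixner weight: a falling factorial of length `i` against a rising factorial of
length `j`. -/
lemma hasSum_meixnerWeight_mul_choose_mul_ascPochhammer {β θ : ℝ} (hβ : 0 < β) (hθ : 1 < θ)
    (i j : ℕ) :
    HasSum (fun n : ℕ => meixnerWeight β θ n * n.choose i *
        (ascPochhammer ℝ j).eval (β + n))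
      (θ⁻¹ ^ i / i.factorial * Real.Gamma (β + i + j) * (1 - θ⁻¹) ^ (-(β + i + j))) := by
  have hq0 : 0 ≤ θ⁻¹ := by positivity
  have hq1 : θ⁻¹ < 1 := inv_lt_one_of_one_lt₀ hθ
  have h := (hasSum_Gamma_add_nat_div_factorial (s := β + i + j) (by positivity) hq0 hq1).mul_left
    (θ⁻¹ ^ i / i.factorial)
  rw [← hasSum_nat_add_iff' i]
  rw [Finset.sum_eq_zero, sub_zero]
  · refine h.of_eq (fun n => ?_) ?_
    · have h1 : ((n + i).choose i : ℝ) = (n + i).factorial / (i.factorial * n.factorial) := by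
        rw [Nat.cast_choose ℝ (Nat.le_add_left i n)]
        simp
      have h2 := Gamma_add_nat_eq_ascPochhammer (show 0 < β + (n + i : ℕ) by positivity) j
      have h3 : β + (n + i : ℕ) + j = β + i + j + n := by push_cast; ring
      rw [h3] at h2
      have hn : (n.factorial : ℝ) ≠ 0 := by positivity
      have hi : (i.factorial : ℝ) ≠ 0 := by positivity
      have hni : ((n + i).factorial : ℝ) ≠ 0 := by positivity
      rw [meixnerWeight, h1, h2, pow_add]
      field_simp
    · ring
  · intro n hn
    rw [Nat.choose_eq_zero_of_lt (Finset.mem_range.mp hn)]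
    simp

lemma hasSum_meixner_mul_ascPochhammer {β θ : ℝ} (hβ : 0 < β) (hθ : 1 < θ) {j k : ℕ}
    (hjk : j ≤ k) :
    HasSum (fun n : ℕ => meixnerWeight β θ n * meixner β θ n k *
        (ascPochhammer ℝ j).eval (β + n))
      (if j = k then (-1) ^ k * (k.factorial : ℝ) * (1 - θ⁻¹) ^ (-(β + k)) else 0) := by
  have hq1 : 0 < 1 - θ⁻¹ := sub_pos.mpr (inv_lt_one_of_one_lt₀ hθ)
  have h := hasSum_sum (s := Finset.range (k + 1)) fun i _ =>
    (hasSum_meixnerWeight_mul_choose_mul_ascPochhammer hβ hθ i j).mul_left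
      (k.choose i * (i.factorial / Real.Gamma (β + i)) * (1 - θ) ^ i)
  refine h.of_eq (fun n => ?_) ?_
  · rw [meixner, Finset.mul_sum, Finset.sum_mul]
    exact Finset.sum_congr rfl fun i _ => by ring
  · have hterm : ∀ i ∈ Finset.range (k + 1),
        k.choose i * (i.factorial / Real.Gamma (β + i)) * (1 - θ) ^ i *
          (θ⁻¹ ^ i / i.factorial * Real.Gamma (β + i + j) * (1 - θ⁻¹) ^ (-(β + i + j))) =
        (1 - θ⁻¹) ^ (-(β + j)) *
          ((-1 : ℝ) ^ i * k.choose i * (ascPochhammer ℝ j).eval (β + i)) := by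
      intro i _
      have hG := (Real.Gamma_pos_of_pos (show 0 < β + i by positivity)).ne'
      have hi : (i.factorial : ℝ) ≠ 0 := by positivity
      have hpow : (1 - θ⁻¹) ^ (-(β + i + j)) * ((1 - θ) ^ i * θ⁻¹ ^ i) =
          (1 - θ⁻¹) ^ (-(β + j)) * (-1) ^ i := by
        have h1 : (1 - θ) * θ⁻¹ = -1 * (1 - θ⁻¹) := by
          have : θ ≠ 0 := by positivity
          field_simp
          ring
        have h2 : (1 - θ⁻¹) ^ (-(β + j)) = (1 - θ⁻¹) ^ (-(β + i + j)) * (1 - θ⁻¹) ^ i := by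
          rw [← Real.rpow_natCast, ← Real.rpow_add hq1]
          congr 1
          ring
        rw [← mul_pow, h1, mul_pow, h2]
        ring
      rw [Gamma_add_nat_eq_ascPochhammer (show 0 < β + i by positivity) j]
      calc _ = k.choose i * (ascPochhammer ℝ j).eval (β + i) *
            ((1 - θ⁻¹) ^ (-(β + i + j)) * ((1 - θ) ^ i * θ⁻¹ ^ i)) := by field_simp
        _ = _ := by rw [hpow]; ring
    rw [Finset.sum_congr rfl hterm, ← Finset.mul_sum,
      sum_neg_one_pow_choose_mul_ascPochhammer β hjk]
    split_ifs with hj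
    · subst hj
      ring
    · simp

/-- Summation against a Meixner polynomial of degree `k` reads off the coefficient of degree `k` of
a polynomial of degree at most `k`. -/
lemma hasSum_meixner_mul_eval {β θ : ℝ} (hβ : 0 < β) (hθ : 1 < θ) {k : ℕ} {P : Polynomial ℝ}
    (hP : P.degree < (k + 1 : ℕ)) :
    HasSum (fun n : ℕ => meixnerWeight β θ n * meixner β θ n k * P.eval (n : ℝ))
      (P.coeff k * ((-1) ^ k * (k.factorial : ℝ) * (1 - θ⁻¹) ^ (-(β + k)))) := by
  suffices H : ∀ j ≤ k + 1, ∀ P : Polynomial ℝ, P.degree < (j : ℕ) →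
      HasSum (fun n : ℕ => meixnerWeight β θ n * meixner β θ n k * P.eval (n : ℝ))
        (P.coeff k * ((-1) ^ k * (k.factorial : ℝ) * (1 - θ⁻¹) ^ (-(β + k)))) from
    H _ le_rfl P hP
  intro j
  induction j with
  | zero =>
    intro _ P hP
    have : P = 0 := by simpa using hP
    simp [this]
  | succ j ih =>
    intro hj P hP
    -- the rising factorial `(n + β) ⋯ (n + β + j - 1)` as a monic polynomial in `n`
    set R : Polynomial ℝ := (ascPochhammer ℝ j).comp (Polynomial.X + Polynomial.C β) with hR
    have hRd : R.natDegree = j := by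
      rw [hR, Polynomial.natDegree_comp, ascPochhammer_natDegree, Polynomial.natDegree_X_add_C,
        mul_one]
    have hRm : R.Monic := (monic_ascPochhammer ℝ j).comp_X_add_C β
    have hRj : R.coeff j = 1 := by rw [← hRd]; exact hRm
    have hQ : (P - Polynomial.C (P.coeff j) * R).degree < (j : ℕ) := by
      rw [Polynomial.degree_lt_iff_coeff_zero] at hP ⊢
      intro m hm
      rcases hm.eq_or_lt with rfl | hlt
      · simp [hRj]
      · rw [Polynomial.coeff_sub, Polynomial.coeff_C_mul, hP m hlt,
          Polynomial.coeff_eq_zero_of_natDegree_lt (by omega : R.natDegree < m)]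
        simp
    have h1 := ih (by omega) _ hQ
    have h2 := (hasSum_meixner_mul_ascPochhammer hβ hθ (by omega : j ≤ k)).mul_left (P.coeff j)
    refine (h1.add h2).of_eq (fun n => ?_) ?_
    · simp only [hR, Polynomial.eval_sub, Polynomial.eval_mul, Polynomial.eval_C,
        Polynomial.eval_comp, Polynomial.eval_add, Polynomial.eval_X]
      rw [add_comm β]
      ring
    · split_ifs with hjk
      · subst hjk
        simp [hRj]
      · rw [Polynomial.coeff_sub, Polynomial.coeff_C_mul,
          Polynomial.coeff_eq_zero_of_natDegree_lt (by omega : R.natDegree < k)]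
        simp

/-- `meixner β θ n k` as a polynomial in `n`. -/
noncomputable def meixnerPoly (β θ : ℝ) (k : ℕ) : Polynomial ℝ :=
  ∑ i ∈ Finset.range (k + 1),
    Polynomial.C (k.choose i / Real.Gamma (β + i) * (1 - θ) ^ i) * descPochhammer ℝ i

lemma eval_meixnerPoly (β θ : ℝ) (n k : ℕ) :
    (meixnerPoly β θ k).eval (n : ℝ) = meixner β θ n k := by
  rw [meixnerPoly, meixner, Polynomial.eval_finsetSum]
  refine Finset.sum_congr rfl fun i _ => ?_
  rw [Polynomial.eval_mul, Polynomial.eval_C, descPochhammer_eval_eq_descFactorial,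
    Nat.descFactorial_eq_factorial_mul_choose]
  push_cast
  ring

lemma degree_meixnerPoly_lt (β θ : ℝ) (k : ℕ) :
    (meixnerPoly β θ k).degree < (k + 1 : ℕ) := by
  refine (Polynomial.degree_sum_le _ _).trans_lt ?_
  rw [Finset.sup_lt_iff (WithBot.bot_lt_coe _)]
  intro i hi
  rw [← Polynomial.smul_eq_C_mul]
  refine (Polynomial.degree_smul_le _ _).trans_lt ?_
  rw [Polynomial.degree_eq_natDegree (monic_descPochhammer ℝ i).ne_zero, descPochhammer_natDegree]
  exact_mod_cast Finset.mem_range.mp hi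

lemma coeff_meixnerPoly_self (β θ : ℝ) (k : ℕ) :
    (meixnerPoly β θ k).coeff k = (1 - θ) ^ k / Real.Gamma (β + k) := by
  have h1 : (descPochhammer ℝ k).coeff k = 1 := by
    have h := (monic_descPochhammer ℝ k).coeff_natDegree
    rwa [descPochhammer_natDegree] at h
  rw [meixnerPoly, Polynomial.finsetSum_coeff, Finset.sum_range_succ, Finset.sum_eq_zero]
  · rw [Polynomial.coeff_C_mul, h1, Nat.choose_self]
    simp
    ring
  · intro i hi
    rw [Polynomial.coeff_C_mul, Polynomial.coeff_eq_zero_of_natDegree_lt, mul_zero]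
    rw [descPochhammer_natDegree]
    exact Finset.mem_range.mp hi

lemma coeff_meixnerPoly_of_lt (β θ : ℝ) {j k : ℕ} (h : j < k) :
    (meixnerPoly β θ j).coeff k = 0 :=
  Polynomial.coeff_eq_zero_of_degree_lt ((degree_meixnerPoly_lt β θ j).trans_le
    (by exact_mod_cast h))

/-- Orthogonality of the Meixner polynomials. -/
lemma hasSum_meixnerWeight_mul_meixner_mul_meixner {β θ : ℝ} (hβ : 0 < β) (hθ : 1 < θ)
    (j k : ℕ) :
    HasSum (fun n : ℕ => meixnerWeight β θ n * meixner β θ n j * meixner β θ n k)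
      (if j = k then (1 - θ⁻¹) ^ (-β) / meixnerWeight β θ k else 0) := by
  wlog hjk : j ≤ k generalizing j k
  · refine (this k j (le_of_not_ge hjk)).of_eq (fun n => ?_) ?_
    · ring
    · simp only [eq_comm (a := j)]
      split_ifs with h
      · rw [h]
      · rfl
  have hd : (meixnerPoly β θ j).degree < (k + 1 : ℕ) :=
    (degree_meixnerPoly_lt β θ j).trans_le (by exact_mod_cast Nat.succ_le_succ hjk)
  have h := hasSum_meixner_mul_eval hβ hθ hd
  simp only [eval_meixnerPoly] at h
  refine h.of_eq (fun n => ?_) ?_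
  · ring
  · split_ifs with hj
    · subst hj
      have hq1 : 0 < 1 - θ⁻¹ := sub_pos.mpr (inv_lt_one_of_one_lt₀ hθ)
      have hθ0 : θ ≠ 0 := by positivity
      have hG := (Real.Gamma_pos_of_pos (show 0 < β + j by positivity)).ne'
      have h1 : (1 - θ) ^ j * (-1) ^ j = θ ^ j * (1 - θ⁻¹) ^ j := by
        rw [← mul_pow, ← mul_pow]
        congr 1
        field_simp
        ring
      have h2 : (1 - θ⁻¹) ^ (-β) = (1 - θ⁻¹) ^ (-(β + j)) * (1 - θ⁻¹) ^ j := by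
        rw [← Real.rpow_natCast, ← Real.rpow_add hq1]
        congr 1
        ring
      rw [coeff_meixnerPoly_self, meixnerWeight, h2, inv_pow]
      generalize (1 - θ⁻¹) ^ (-(β + (j : ℝ))) = A
      generalize hB : (1 - θ⁻¹) ^ j = B at *
      have := pow_ne_zero j hθ0
      calc _ = A * j.factorial / Real.Gamma (β + j) * (θ ^ j * B) := by field_simp
        _ = _ := by rw [← h1]; ring
    · rw [coeff_meixnerPoly_of_lt β θ (lt_of_le_of_ne hjk hj), zero_mul]

/-! ### Symmetric orthonormal matrices -/

/-- The columns of an infinite real symmetric matrix with orthonormal columns form a Hilbert basis.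
Symmetry makes the rows orthonormal too, so that every standard basis vector is the sum of its
expansion in the columns. -/
lemma exists_hilbertBasis_of_symmetric_of_orthonormal {A : ℕ → ℕ → ℝ} (hA : ∀ n k, A n k = A k n)
    (hAA : ∀ j k, HasSum (fun n => A n j * A n k) (if j = k then 1 else 0)) :
    ∃ b : HilbertBasis ℕ ℂ ℓ²(ℕ, ℂ), ∀ k n, b k n = A n k := by
  have hmem : ∀ k, Memℓp (fun n => (A n k : ℂ)) 2 := by
    intro k
    refine memℓp_gen ?_
    have h := (hAA k k).summable
    refine h.congr fun n => ?_
    simp [pow_two]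
  let v : ℕ → ℓ²(ℕ, ℂ) := fun k => ⟨fun n => (A n k : ℂ), hmem k⟩
  have hvapp : ∀ k n, v k n = A n k := fun _ _ => rfl
  have hv : Orthonormal ℂ v := by
    rw [orthonormal_iff_ite]
    intro j k
    rw [lp.inner_eq_tsum]
    simp only [hvapp, RCLike.inner_apply, Complex.conj_ofReal]
    refine ((Complex.hasSum_ofReal.mpr (hAA j k)).of_eq (fun n => ?_) ?_).tsum_eq
    · push_cast
      ring
    · split_ifs <;> simp
  have horth : (Submodule.span ℂ (Set.range v))ᗮ = ⊥ := by
    rw [Submodule.eq_bot_iff]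
    intro u hu
    have hu0 : ∀ k, ⟪v k, u⟫_ℂ = 0 := fun k =>
      (Submodule.mem_orthogonal _ u).mp hu _ (Submodule.subset_span ⟨k, rfl⟩)
    ext m
    have hsum := hv.orthogonalFamily.hasSum_linearIsometry (v m)
    set w := hv.orthogonalFamily.linearIsometry (v m)
    -- the expansion in the columns whose coefficients are the `m`-th row sums to a standard basis
    -- vector, because the rows are orthonormal as well
    have hw : w = lp.single 2 m (1 : ℂ) := by
      ext n
      have h1 : HasSum (fun k => (A k m : ℂ) * A n k) (w n) :=
        (hsum.mapL (lp.evalCLM ℂ (fun _ : ℕ => ℂ) 2 n)).of_eq (fun k => rfl) rfl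
      have h2 : HasSum (fun k => (A k m : ℂ) * A n k) ((lp.single 2 m (1 : ℂ) : ℓ²(ℕ, ℂ)) n) :=
        (Complex.hasSum_ofReal.mpr (hAA m n)).of_eq (fun k => by rw [hA n k]; push_cast; ring)
          (by rw [lp.single_apply, Pi.single_apply]; simp [eq_comm, apply_ite])
      exact h1.unique h2
    have h2 : ⟪w, u⟫_ℂ = 0 := by
      have h3 : HasSum (fun k => (0 : ℂ)) ⟪u, w⟫_ℂ :=
        (hsum.mapL (innerSL ℂ u)).of_eq (fun k => by
          simp [inner_eq_zero_symm.mp (hu0 k)]) rfl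
      exact inner_eq_zero_symm.mp (h3.unique hasSum_zero)
    rw [hw, lp.inner_single_left] at h2
    simpa using h2
  exact ⟨HilbertBasis.mkOfOrthogonalEqBot hv horth, fun k n => by
    rw [HilbertBasis.coe_mkOfOrthogonalEqBot]⟩

/-- The symmetric orthogonal matrix `√(W n) √(W k) M n k`, up to a constant factor, where `W` is the
Meixner weight and `M` the Meixner polynomials. -/
noncomputable def meixnerMatrix (β θ : ℝ) (n k : ℕ) : ℝ :=
  (1 - θ⁻¹) ^ (β / 2) * (√(meixnerWeight β θ n) * √(meixnerWeight β θ k)) * meixner β θ n k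

lemma meixnerMatrix_comm (β θ : ℝ) (n k : ℕ) : meixnerMatrix β θ n k = meixnerMatrix β θ k n := by
  rw [meixnerMatrix, meixnerMatrix, meixner_comm]
  ring

lemma hasSum_meixnerMatrix_mul_meixnerMatrix {β θ : ℝ} (hβ : 0 < β) (hθ : 1 < θ) (j k : ℕ) :
    HasSum (fun n => meixnerMatrix β θ n j * meixnerMatrix β θ n k) (if j = k then 1 else 0) := by
  have hq1 : 0 < 1 - θ⁻¹ := sub_pos.mpr (inv_lt_one_of_one_lt₀ hθ)
  have hW := meixnerWeight_pos (θ := θ) hβ (by positivity)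
  have hq : (1 - θ⁻¹) ^ β = (1 - θ⁻¹) ^ (β / 2) * (1 - θ⁻¹) ^ (β / 2) := by
    rw [← Real.rpow_add hq1, add_halves]
  refine ((hasSum_meixnerWeight_mul_meixner_mul_meixner hβ hθ j k).mul_left
    ((1 - θ⁻¹) ^ β * (√(meixnerWeight β θ j) * √(meixnerWeight β θ k)))).of_eq (fun n => ?_) ?_
  · have := Real.mul_self_sqrt (hW n).le
    rw [meixnerMatrix, meixnerMatrix, hq]
    calc _ = (1 - θ⁻¹) ^ (β / 2) * (1 - θ⁻¹) ^ (β / 2) *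
          (√(meixnerWeight β θ j) * √(meixnerWeight β θ k)) *
          (√(meixnerWeight β θ n) * √(meixnerWeight β θ n) * meixner β θ n j *
            meixner β θ n k) := by ring
      _ = _ := by rw [this]
  · split_ifs with h
    · subst h
      rw [Real.mul_self_sqrt (hW j).le, Real.rpow_neg hq1.le]
      have := (hW j).ne'
      have hq0 := (Real.rpow_pos_of_pos hq1 β).ne'
      generalize (1 - θ⁻¹) ^ β = c at *
      field_simp
    · simp

lemma exists_hilbertBasis_meixnerMatrix {β θ : ℝ} (hβ : 0 < β) (hθ : 1 < θ) :
    ∃ b : HilbertBasis ℕ ℂ ℓ²(ℕ, ℂ), ∀ k n, b k n = meixnerMatrix β θ n k :=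
  exists_hilbertBasis_of_symmetric_of_orthonormal (meixnerMatrix_comm β θ)
    (hasSum_meixnerMatrix_mul_meixnerMatrix hβ hθ)

/-! ### A Hilbert space of entire functions -/

lemma differentiable_tsum_mul_pow {c : ℕ → ℂ} (hc : ∀ r : ℝ, Summable fun n => ‖c n‖ * r ^ n) :
    Differentiable ℂ fun z : ℂ => ∑' n, c n * z ^ n := by
  intro z
  have h : DifferentiableOn ℂ (fun z : ℂ => ∑' n, c n * z ^ n) (Metric.ball 0 (‖z‖ + 1)) := by
    refine Complex.differentiableOn_tsum_of_summable_norm (hc (‖z‖ + 1))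
      (fun n => by fun_prop) Metric.isOpen_ball fun n w hw => ?_
    rw [norm_mul, norm_pow]
    gcongr
    exact (mem_ball_zero_iff.mp hw).le
  exact h.differentiableAt (Metric.isOpen_ball.mem_nhds (by simp))

lemma summable_pow_div_factorial_mul_Gamma {β : ℝ} (hβ : 0 < β) (y : ℝ) :
    Summable fun n : ℕ => y ^ n / (n.factorial * Real.Gamma (β + n)) := by
  refine summable_of_ratio_norm_eventually_le (r := 1 / 2) (by norm_num) ?_
  filter_upwards [Filter.eventually_ge_atTop 1, Filter.eventually_ge_atTop ⌈2 * |y|⌉₊] with n h1 h2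
  have h1' : (1 : ℝ) ≤ n := by exact_mod_cast h1
  have h2' : 2 * |y| ≤ n := (Nat.le_ceil _).trans (by exact_mod_cast h2)
  have hG := Real.Gamma_pos_of_pos (show 0 < β + n by positivity)
  have hstep : y ^ (n + 1) / ((n + 1).factorial * Real.Gamma (β + (n + 1 : ℕ))) =
      y / ((n + 1) * (β + n)) * (y ^ n / (n.factorial * Real.Gamma (β + n))) := by
    have hn : β + n ≠ 0 := by positivity
    push_cast [Nat.factorial_succ]
    rw [← add_assoc, Real.Gamma_add_one hn, pow_succ]
    field_simp
  rw [hstep, norm_mul]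
  gcongr
  rw [Real.norm_eq_abs, abs_div, abs_of_pos (show (0 : ℝ) < (n + 1) * (β + n) by positivity),
    div_le_iff₀ (by positivity)]
  nlinarith

/-- The weights of the power series of the entire functions `z ↦ exp (z / (θ - 1)) * F z`: they are
of the form `∑ n, u n * fockCoeff β θ n * z ^ n` with `u` square summable. -/
noncomputable def fockCoeff (β θ : ℝ) (n : ℕ) : ℝ :=
  ((θ - 1) ^ n * n.factorial * √(meixnerWeight β θ n))⁻¹

lemma fockCoeff_pos {β θ : ℝ} (hβ : 0 < β) (hθ : 1 < θ) (n : ℕ) : 0 < fockCoeff β θ n := by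
  have := meixnerWeight_pos (θ := θ) hβ (by positivity) n
  have : 0 < θ - 1 := sub_pos.mpr hθ
  unfold fockCoeff
  positivity

lemma inv_fockCoeff_sq {β θ : ℝ} (hβ : 0 < β) (hθ : 1 < θ) (n : ℕ) :
    (fockCoeff β θ n ^ 2)⁻¹ =
      ((θ - 1) ^ 2 / θ) ^ n * (n.factorial * Real.Gamma (β + n)) := by
  have hW := meixnerWeight_pos (θ := θ) hβ (by positivity) n
  have hθ0 : 0 < θ := by positivity
  rw [fockCoeff, inv_pow, inv_inv, mul_pow, Real.sq_sqrt hW.le, meixnerWeight, div_pow, inv_pow]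
  field_simp
  rw [← pow_mul, ← pow_mul, mul_comm]

lemma summable_fockCoeff_mul_pow_sq {β θ : ℝ} (hβ : 0 < β) (hθ : 1 < θ) (r : ℝ) :
    Summable fun n => (fockCoeff β θ n * r ^ n) ^ 2 := by
  refine (summable_pow_div_factorial_mul_Gamma hβ (r ^ 2 / ((θ - 1) ^ 2 / θ))).congr fun n => ?_
  rw [← inv_inv ((fockCoeff β θ n * r ^ n) ^ 2), mul_pow, mul_inv, inv_fockCoeff_sq hβ hθ, div_pow]
  simp only [div_eq_mul_inv, mul_inv, inv_inv]
  ring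

lemma memℓp_fockCoeff_mul_pow {β θ : ℝ} (hβ : 0 < β) (hθ : 1 < θ) (z : ℂ) :
    Memℓp (fun n => (fockCoeff β θ n : ℂ) * conj z ^ n) 2 := by
  refine memℓp_gen ((summable_fockCoeff_mul_pow_sq hβ hθ ‖z‖).congr fun n => ?_)
  simp [mul_pow]

/-- The vector of `ℓ²` representing evaluation at `z` of power series with square summable
normalized coefficients. -/
noncomputable def fockKernel {β θ : ℝ} (hβ : 0 < β) (hθ : 1 < θ) (z : ℂ) : ℓ²(ℕ, ℂ) :=
  ⟨fun n => (fockCoeff β θ n : ℂ) * conj z ^ n, memℓp_fockCoeff_mul_pow hβ hθ z⟩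

lemma hasSum_inner_fockKernel {β θ : ℝ} (hβ : 0 < β) (hθ : 1 < θ) (z : ℂ) (u : ℓ²(ℕ, ℂ)) :
    HasSum (fun n => u n * fockCoeff β θ n * z ^ n) ⟪fockKernel hβ hθ z, u⟫_ℂ := by
  refine (lp.hasSum_inner (fockKernel hβ hθ z) u).of_eq (fun n => ?_) rfl
  simp [fockKernel]
  ring

lemma differentiable_inner_fockKernel {β θ : ℝ} (hβ : 0 < β) (hθ : 1 < θ) (u : ℓ²(ℕ, ℂ)) :
    Differentiable ℂ fun z => ⟪fockKernel hβ hθ z, u⟫_ℂ := by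
  have h : (fun z => ⟪fockKernel hβ hθ z, u⟫_ℂ) = fun z => ∑' n, u n * fockCoeff β θ n * z ^ n :=
    funext fun z => (hasSum_inner_fockKernel hβ hθ z u).tsum_eq.symm
  rw [h]
  refine differentiable_tsum_mul_pow fun r => ?_
  refine (hasSum_inner_fockKernel hβ hθ r u).summable.norm.of_norm_bounded_eventually ?_
  refine Filter.Eventually.of_forall fun n => ?_
  simp

/-- The `k`-th orthonormal Laguerre polynomial is a hypergeometric sum. The factor `θ ^ k` cancels the
power of `θ` in the Meixner weight, so that the right-hand side does not depend on `θ`. -/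
lemma laguerreON_eq {ν θ : ℝ} (hν : -1 < ν) (hθ : 0 < θ) (k : ℕ) (x : ℝ) :
    laguerreON ν k x = √(meixnerWeight (ν + 1) θ k * θ ^ k) *
      ∑ i ∈ Finset.range (k + 1), k.choose i / Real.Gamma (ν + 1 + i) * (-x) ^ i := by
  have hG := Real.Gamma_pos_of_pos (show 0 < ν + 1 + k by linarith [k.cast_nonneg (α := ℝ)])
  have h1 : meixnerWeight (ν + 1) θ k * θ ^ k = Real.Gamma (ν + 1 + k) / k.factorial := by
    rw [meixnerWeight, inv_pow]
    field_simp
  have h2 : √(k.factorial / Real.Gamma (ν + 1 + k)) * (Real.Gamma (ν + 1 + k) / k.factorial) =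
      √(Real.Gamma (ν + 1 + k) / k.factorial) := by
    rw [← inv_div (Real.Gamma (ν + 1 + k)), Real.sqrt_inv, inv_mul_eq_div, Real.div_sqrt]
  have h3 : laguerreL ν k x = Real.Gamma (ν + 1 + k) / k.factorial *
      ∑ i ∈ Finset.range (k + 1), k.choose i / Real.Gamma (ν + 1 + i) * (-x) ^ i := by
    rw [laguerreL, Finset.mul_sum]
    refine Finset.sum_congr rfl fun i hi => ?_
    have hik : i ≤ k := Nat.lt_succ_iff.mp (Finset.mem_range.mp hi)
    have hk : (k.factorial : ℝ) ≠ 0 := by positivity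
    rw [Nat.cast_choose ℝ hik, neg_pow x, show ν + i + 1 = ν + 1 + i by ring,
      show (k : ℝ) + ν + 1 = ν + 1 + k by ring]
    field_simp
  rw [h1, laguerreON, h3, ← mul_assoc, show (k : ℝ) + ν + 1 = ν + 1 + k by ring, h2]

lemma hasSum_choose_mul_pow_div_factorial (i : ℕ) (w : ℂ) :
    HasSum (fun n : ℕ => (n.choose i : ℂ) * i.factorial * (w ^ n / n.factorial))
      (w ^ i * Complex.exp w) := by
  have h := (NormedSpace.expSeries_div_hasSum_exp (𝔸 := ℂ) w).mul_left (w ^ i)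
  rw [← Complex.exp_eq_exp_ℂ] at h
  rw [← hasSum_nat_add_iff' i, Finset.sum_eq_zero, sub_zero]
  · refine h.of_eq (fun n => ?_) rfl
    have h1 : ((n + i).choose i : ℂ) = (n + i).factorial / (i.factorial * n.factorial) := by
      rw [Nat.cast_choose ℂ (Nat.le_add_left i n)]
      simp
    have hn : (n.factorial : ℂ) ≠ 0 := by exact_mod_cast n.factorial_ne_zero
    have hi : (i.factorial : ℂ) ≠ 0 := by exact_mod_cast i.factorial_ne_zero
    have hni : ((n + i).factorial : ℂ) ≠ 0 := by exact_mod_cast (n + i).factorial_ne_zero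
    rw [h1, pow_add]
    field_simp
  · intro n hn
    rw [Nat.choose_eq_zero_of_lt (Finset.mem_range.mp hn)]
    simp

/-- The exponential generating function of the Meixner polynomials `n ↦ meixner β θ n k` is an
exponential times a Laguerre polynomial. -/
lemma inner_fockKernel_eq_laguerreON {ν θ : ℝ} (hβ : 0 < ν + 1) (hθ : 1 < θ) {v : ℓ²(ℕ, ℂ)} {k : ℕ}
    (hv : ∀ n, v n = meixnerMatrix (ν + 1) θ n k) (x : ℝ) :
    ⟪fockKernel hβ hθ x, v⟫_ℂ = Complex.exp (x / (θ - 1)) *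
      ((1 - θ⁻¹) ^ ((ν + 1) / 2) * √(θ ^ k)⁻¹ * laguerreON ν k x : ℝ) := by
  have hθ0 : 0 < θ := by positivity
  have hθ1 : (θ - 1 : ℂ) ≠ 0 := by
    exact_mod_cast (sub_pos.mpr hθ).ne'
  have hW := meixnerWeight_pos (θ := θ) hβ hθ0
  refine (hasSum_inner_fockKernel hβ hθ x v).unique ?_
  set w : ℂ := x / (θ - 1) with hw
  set c : ℂ := (((1 - θ⁻¹) ^ ((ν + 1) / 2) * √(meixnerWeight (ν + 1) θ k) : ℝ) : ℂ) with hc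
  have h := (hasSum_sum (s := Finset.range (k + 1)) fun i _ =>
    (hasSum_choose_mul_pow_div_factorial i w).mul_left
      ((k.choose i / Real.Gamma (ν + 1 + i) * (1 - θ) ^ i : ℝ) : ℂ)).mul_left c
  refine h.of_eq (fun n => ?_) ?_
  · have hs : (√(meixnerWeight (ν + 1) θ n) : ℂ) ≠ 0 := by
      exact_mod_cast (Real.sqrt_pos.mpr (hW n)).ne'
    have hn : (n.factorial : ℂ) ≠ 0 := by exact_mod_cast n.factorial_ne_zero
    have hpow := pow_ne_zero n hθ1
    have h1 : v n * fockCoeff (ν + 1) θ n * (x : ℂ) ^ n =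
        c * (meixner (ν + 1) θ n k * (w ^ n / n.factorial)) := by
      rw [hv, meixnerMatrix, fockCoeff, hc, hw, div_pow]
      push_cast
      generalize (√(meixnerWeight (ν + 1) θ n) : ℂ) = s at *
      generalize ((θ : ℂ) - 1) ^ n = t at *
      generalize (n.factorial : ℂ) = m at *
      generalize (((1 - θ⁻¹) ^ ((ν + 1) / 2) : ℝ) : ℂ) = d
      field_simp
    rw [h1, meixner]
    push_cast
    rw [Finset.sum_mul]
    congr 1
    refine Finset.sum_congr rfl fun i _ => ?_
    ring
  · rw [laguerreON_eq (by linarith) hθ0]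
    have hs : √(θ ^ k)⁻¹ * √(meixnerWeight (ν + 1) θ k * θ ^ k) = √(meixnerWeight (ν + 1) θ k) := by
      rw [← Real.sqrt_mul (by positivity), mul_comm (meixnerWeight _ _ _),
        inv_mul_cancel_left₀ (by positivity)]
    -- the argument `1 - θ` of the Meixner polynomial cancels the scaling `z / (θ - 1)`
    have hx : ∀ i : ℕ, ((1 - θ : ℝ) : ℂ) ^ i * w ^ i = ((-x : ℝ) : ℂ) ^ i := by
      intro i
      rw [← mul_pow, hw]
      congr 1
      push_cast
      field_simp
      ring
    rw [← hs] at hc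
    rw [hc, Finset.mul_sum, Finset.mul_sum]
    push_cast
    simp only [Finset.mul_sum]
    refine Finset.sum_congr rfl fun i _ => ?_
    have := hx i
    push_cast at this
    rw [← this]
    ring

/-! ### Determinacy of measures with exponential moments -/

lemma eventuallyEq_of_iteratedDeriv_eq {f g : ℂ → ℂ} {x : ℂ} (hf : AnalyticAt ℂ f x)
    (hg : AnalyticAt ℂ g x) (h : ∀ n, iteratedDeriv n f x = iteratedDeriv n g x) :
    f =ᶠ[nhds x] g := by
  have h1 := hf.hasFPowerSeriesAt.sub hg.hasFPowerSeriesAt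
  simp only [h, sub_self] at h1
  filter_upwards [h1.eventually_eq_zero] with y hy
  exact sub_eq_zero.mp hy

/-- A finite measure on the line which integrates `exp (t * x)` for all small `t` is determined by
its moments: its complex moment generating function is holomorphic on a vertical strip containing
the imaginary axis, and the moments are its Taylor coefficients at `0`. -/
lemma measure_ext_of_moment_eq {μ μ' : Measure ℝ} [IsFiniteMeasure μ] [IsFiniteMeasure μ']
    (hμ : 0 ∈ interior (ProbabilityTheory.integrableExpSet id μ))
    (hμ' : 0 ∈ interior (ProbabilityTheory.integrableExpSet id μ'))
    (h : ∀ n : ℕ, ∫ x, x ^ n ∂μ = ∫ x, x ^ n ∂μ') : μ = μ' := by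
  open ProbabilityTheory in
  set S : Set ℂ := Complex.re ⁻¹' (interior (integrableExpSet id μ) ∩
    interior (integrableExpSet id μ')) with hS
  have hconv : Convex ℝ (interior (integrableExpSet id μ) ∩
      interior (integrableExpSet id μ')) :=
    convex_integrableExpSet.interior.inter convex_integrableExpSet.interior
  have hSconn : IsPreconnected S :=
    (hconv.linear_preimage Complex.reLm).isPreconnected
  have hA : AnalyticOnNhd ℂ (complexMGF id μ) S :=
    analyticOnNhd_complexMGF.mono fun z hz => hz.1
  have hA' : AnalyticOnNhd ℂ (complexMGF id μ') S :=
    analyticOnNhd_complexMGF.mono fun z hz => hz.2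
  have h0 : (0 : ℂ) ∈ S := ⟨hμ, hμ'⟩
  have hder : ∀ n, iteratedDeriv n (complexMGF id μ) 0 = iteratedDeriv n (complexMGF id μ') 0 := by
    intro n
    rw [iteratedDeriv_complexMGF h0.1, iteratedDeriv_complexMGF h0.2]
    simp only [id_eq, zero_mul, Complex.exp_zero, mul_one, ← Complex.ofReal_pow]
    rw [integral_complex_ofReal, integral_complex_ofReal, h n]
  have heq := hA.eqOn_of_preconnected_of_eventuallyEq hA' hSconn h0
    (eventuallyEq_of_iteratedDeriv_eq (hA 0 h0) (hA' 0 h0) hder)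
  refine Measure.ext_of_charFun (funext fun t => ?_)
  rw [← complexMGF_id_mul_I, ← complexMGF_id_mul_I]
  exact heq (by simpa [hS] using ⟨hμ, hμ'⟩)

lemma ae_eq_zero_of_forall_integral_pow_mul_eq_zero {μ : Measure ℝ} {g : ℝ → ℝ} {δ : ℝ}
    (hδ : 0 < δ) (hg : ∀ t ∈ Ioo (-δ) δ, Integrable (fun x => Real.exp (t * x) * g x) μ)
    (h : ∀ n : ℕ, ∫ x, x ^ n * g x ∂μ = 0) : g =ᵐ[μ] 0 := by
  have hg0 : Integrable g μ := by
    simpa using hg 0 ⟨neg_lt_zero.mpr hδ, hδ⟩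
  have key : ∀ f : ℝ → ℝ, Integrable f μ →
      (∀ t ∈ Ioo (-δ) δ, Integrable (fun x => Real.exp (t * x) * f x) μ) →
      IsFiniteMeasure (μ.withDensity fun x => ENNReal.ofReal (f x)) ∧
      0 ∈ interior (ProbabilityTheory.integrableExpSet id
        (μ.withDensity fun x => ENNReal.ofReal (f x))) ∧
      ∀ n : ℕ, Integrable (fun x => max (f x) 0 * x ^ n) μ ∧
        ∫ x, x ^ n ∂(μ.withDensity fun x => ENNReal.ofReal (f x)) =
          ∫ x, max (f x) 0 * x ^ n ∂μ := by
    intro f hf hft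
    have hm : AEMeasurable (fun x => ENNReal.ofReal (f x)) μ := hf.aemeasurable.ennreal_ofReal
    have hlt : ∀ᵐ x ∂μ, ENNReal.ofReal (f x) < ⊤ := Filter.Eventually.of_forall fun _ => by simp
    have hsub : Ioo (-δ) δ ⊆ ProbabilityTheory.integrableExpSet id
        (μ.withDensity fun x => ENNReal.ofReal (f x)) := by
      intro t ht
      rw [ProbabilityTheory.integrableExpSet, mem_ofPred_eq,
        integrable_withDensity_iff_integrable_smul₀' hm hlt]
      refine (hft t ht).pos_part.congr (Filter.Eventually.of_forall fun x => ?_)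
      have he := (Real.exp_pos (t * x)).le
      simp only [ENNReal.toReal_ofReal', smul_eq_mul, id_eq]
      rw [max_mul_of_nonneg _ _ he, zero_mul, mul_comm]
    have hint : 0 ∈ interior (ProbabilityTheory.integrableExpSet id
        (μ.withDensity fun x => ENNReal.ofReal (f x))) :=
      mem_interior.mpr ⟨_, hsub, isOpen_Ioo, neg_lt_zero.mpr hδ, hδ⟩
    refine ⟨isFiniteMeasure_withDensity_ofReal hf.2, hint, fun n => ⟨?_, ?_⟩⟩
    · have h1 := ProbabilityTheory.integrable_pow_of_mem_interior_integrableExpSet hint n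
      rw [integrable_withDensity_iff_integrable_smul₀' hm hlt] at h1
      simpa [ENNReal.toReal_ofReal'] using h1
    · rw [integral_withDensity_eq_integral_toReal_smul₀ hm hlt]
      simp [ENNReal.toReal_ofReal']
  -- the measures with densities the positive and the negative part of `g` have the same moments
  obtain ⟨hfin, hexp, hmom⟩ := key g hg0 hg
  obtain ⟨hfin', hexp', hmom'⟩ := key (fun x => -g x) hg0.neg fun t ht => by
    simpa using (hg t ht).neg
  have heq := measure_ext_of_moment_eq hexp hexp' fun n => by
    rw [(hmom n).2, (hmom' n).2, ← sub_eq_zero, ← integral_sub (hmom n).1 (hmom' n).1]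
    refine Eq.trans ?_ (h n)
    refine integral_congr_ae (Filter.Eventually.of_forall fun x => ?_)
    simp only
    rw [← sub_mul, mul_comm, max_zero_sub_max_neg_zero_eq_self]
  have hae := (withDensity_eq_iff hg0.aemeasurable.ennreal_ofReal
    hg0.neg.aemeasurable.ennreal_ofReal hg0.lintegral_lt_top.ne).mp heq
  filter_upwards [hae] with x hx
  have h1 := congrArg ENNReal.toReal hx
  simp only [ENNReal.toReal_ofReal'] at h1
  rcases le_total 0 (g x) with h2 | h2
  · simpa [max_eq_left h2, h2] using h1
  · simpa [max_eq_right h2, h2] using h1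

/-! ### Laguerre polynomials form a Hilbert basis -/

lemma laguerreWeight_pos (ν : ℝ) {x : ℝ} (hx : 0 < x) : 0 < laguerreWeight ν x :=
  mul_pos (Real.rpow_pos_of_pos hx ν) (Real.exp_pos _)

lemma measurable_laguerreWeight (ν : ℝ) : Measurable (laguerreWeight ν) := by
  unfold laguerreWeight
  fun_prop

lemma ae_laguerreMeasure_iff {ν : ℝ} {p : ℝ → Prop} :
    (∀ᵐ x ∂laguerreMeasure ν, p x) ↔ ∀ᵐ x ∂volume.restrict (Ioi (0 : ℝ)), p x := by
  rw [laguerreMeasure, ae_withDensity_iff (measurable_laguerreWeight ν).ennreal_ofReal]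
  refine Filter.eventually_congr ?_
  filter_upwards [ae_restrict_mem measurableSet_Ioi] with x hx
  simp [laguerreWeight_pos ν hx]

lemma integrable_laguerreMeasure_iff {E : Type*} [NormedAddCommGroup E] [NormedSpace ℝ E]
    {ν : ℝ} {g : ℝ → E} :
    Integrable g (laguerreMeasure ν) ↔
      IntegrableOn (fun x => laguerreWeight ν x • g x) (Ioi 0) := by
  rw [laguerreMeasure, integrable_withDensity_iff_integrable_smul'
    (measurable_laguerreWeight ν).ennreal_ofReal (Filter.Eventually.of_forall fun _ => by simp)]
  refine integrable_congr ?_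
  filter_upwards [ae_restrict_mem measurableSet_Ioi] with x hx
  rw [ENNReal.toReal_ofReal (laguerreWeight_pos ν hx).le]

lemma integral_laguerreMeasure {E : Type*} [NormedAddCommGroup E] [NormedSpace ℝ E]
    (ν : ℝ) (g : ℝ → E) :
    ∫ x, g x ∂laguerreMeasure ν = ∫ x in Ioi 0, laguerreWeight ν x • g x := by
  rw [laguerreMeasure, integral_withDensity_eq_integral_toReal_smul
    (measurable_laguerreWeight ν).ennreal_ofReal (Filter.Eventually.of_forall fun _ => by simp)]
  refine integral_congr_ae ?_
  filter_upwards [ae_restrict_mem measurableSet_Ioi] with x hx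
  rw [ENNReal.toReal_ofReal (laguerreWeight_pos ν hx).le]

lemma integrable_pow_mul_exp_laguerreMeasure {ν : ℝ} (hν : -1 < ν) (n : ℕ) {t : ℝ} (ht : t < 1) :
    Integrable (fun x => x ^ n * Real.exp (t * x)) (laguerreMeasure ν) := by
  rw [integrable_laguerreMeasure_iff]
  have h := integrableOn_rpow_mul_exp_neg_mul_rpow (p := 1) (s := ν + n) (b := 1 - t)
    (by linarith [n.cast_nonneg (α := ℝ)]) one_pos (by linarith)
  refine h.congr_fun (fun x hx => ?_) measurableSet_Ioi
  simp only [laguerreWeight, smul_eq_mul, Real.rpow_one]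
  rw [Real.rpow_add hx, Real.rpow_natCast, show -(1 - t) * x = -x + t * x by ring, Real.exp_add]
  ring

lemma integrable_pow_laguerreMeasure {ν : ℝ} (hν : -1 < ν) (n : ℕ) :
    Integrable (fun x => x ^ n) (laguerreMeasure ν) := by
  simpa using integrable_pow_mul_exp_laguerreMeasure hν n (t := 0) one_pos

lemma integral_pow_laguerreMeasure {ν : ℝ} (hν : -1 < ν) (n : ℕ) :
    ∫ x, x ^ n ∂laguerreMeasure ν = Real.Gamma (ν + 1 + n) := by
  rw [integral_laguerreMeasure, Real.Gamma_eq_integral (by linarith [n.cast_nonneg (α := ℝ)])]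
  refine setIntegral_congr_fun measurableSet_Ioi fun x hx => ?_
  simp only [laguerreWeight, smul_eq_mul]
  rw [show ν + 1 + n - 1 = ν + n by ring, Real.rpow_add hx, Real.rpow_natCast]
  ring

lemma memLp_pow_laguerreMeasure {ν : ℝ} (hν : -1 < ν) (n : ℕ) :
    MemLp (fun x : ℝ => x ^ n) 2 (laguerreMeasure ν) := by
  rw [memLp_two_iff_integrable_sq (by fun_prop)]
  simpa [← pow_mul] using integrable_pow_laguerreMeasure hν (n * 2)

lemma memLp_laguerreON {ν : ℝ} (hν : -1 < ν) (k : ℕ) :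
    MemLp (laguerreON ν k) 2 (laguerreMeasure ν) := by
  have h : laguerreON ν k = fun x => √(meixnerWeight (ν + 1) 1 k * 1 ^ k) *
      ∑ i ∈ Finset.range (k + 1), k.choose i / Real.Gamma (ν + 1 + i) * (-1) ^ i * x ^ i := by
    ext x
    rw [laguerreON_eq hν one_pos]
    congr 1
    exact Finset.sum_congr rfl fun i _ => by rw [neg_pow, mul_assoc]
  rw [h]
  exact (memLp_finsetSum _ fun i _ => (memLp_pow_laguerreMeasure hν i).const_mul _).const_mul _

/-- The integral is an alternating sum of Gamma values, that is, a finite difference of a rising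
factorial. -/
lemma integral_laguerreON_mul_pow {ν : ℝ} (hν : -1 < ν) {j k : ℕ} (hjk : j ≤ k) :
    ∫ x, laguerreON ν k x * x ^ j ∂laguerreMeasure ν =
      if j = k then (-1) ^ k * √(k.factorial * Real.Gamma (ν + 1 + k)) else 0 := by
  have hG : ∀ i : ℕ, 0 < Real.Gamma (ν + 1 + i) := fun i =>
    Real.Gamma_pos_of_pos (by linarith [i.cast_nonneg (α := ℝ)])
  have hW : meixnerWeight (ν + 1) 1 k * 1 ^ k = Real.Gamma (ν + 1 + k) / k.factorial := by
    simp [meixnerWeight]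
  have h : (fun x => laguerreON ν k x * x ^ j) = fun x =>
      ∑ i ∈ Finset.range (k + 1), √(Real.Gamma (ν + 1 + k) / k.factorial) *
        (k.choose i / Real.Gamma (ν + 1 + i) * (-1) ^ i) * x ^ (i + j) := by
    ext x
    rw [laguerreON_eq hν one_pos, hW, Finset.mul_sum, Finset.sum_mul]
    refine Finset.sum_congr rfl fun i _ => ?_
    rw [neg_pow, pow_add]
    ring
  rw [h, integral_finsetSum _ fun i _ => (integrable_pow_laguerreMeasure hν (i + j)).const_mul _]
  have hterm : ∀ i ∈ Finset.range (k + 1),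
      ∫ x, √(Real.Gamma (ν + 1 + k) / k.factorial) *
        (k.choose i / Real.Gamma (ν + 1 + i) * (-1) ^ i) * x ^ (i + j) ∂laguerreMeasure ν =
      √(Real.Gamma (ν + 1 + k) / k.factorial) *
        ((-1) ^ i * k.choose i * (ascPochhammer ℝ j).eval (ν + 1 + i)) := by
    intro i _
    rw [integral_const_mul, integral_pow_laguerreMeasure hν]
    push_cast
    rw [← add_assoc, Gamma_add_nat_eq_ascPochhammer (s := ν + 1 + i)
      (by linarith [i.cast_nonneg (α := ℝ)])]
    have := (hG i).ne'
    field_simp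
  rw [Finset.sum_congr rfl hterm, ← Finset.mul_sum,
    sum_neg_one_pow_choose_mul_ascPochhammer _ hjk, mul_ite, mul_zero]
  congr 1
  have hf : (0 : ℝ) < k.factorial := by positivity
  have h1 : √(Real.Gamma (ν + 1 + k) / k.factorial) * k.factorial =
      √(k.factorial * Real.Gamma (ν + 1 + k)) := by
    nth_rewrite 2 [← Real.sqrt_sq hf.le]
    rw [← Real.sqrt_mul (by have := hG k; positivity)]
    congr 1
    field_simp
  rw [← h1]
  ring

/-- `laguerreON ν k` as an element of `L²(x ^ ν * e ^ (-x) dx)`. -/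
noncomputable def laguerreLp {ν : ℝ} (hν : -1 < ν) (k : ℕ) : Lp ℂ 2 (laguerreMeasure ν) :=
  (memLp_laguerreON hν k).ofReal.toLp

lemma coeFn_laguerreLp {ν : ℝ} (hν : -1 < ν) (k : ℕ) :
    laguerreLp hν k =ᵐ[laguerreMeasure ν] fun x => (laguerreON ν k x : ℂ) :=
  (memLp_laguerreON hν k).ofReal.coeFn_toLp

lemma inner_laguerreLp {ν : ℝ} (hν : -1 < ν) (k : ℕ) (g : Lp ℂ 2 (laguerreMeasure ν)) :
    ⟪laguerreLp hν k, g⟫_ℂ = ∫ x, g x * (laguerreON ν k x : ℂ) ∂laguerreMeasure ν := by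
  rw [L2.inner_def]
  refine integral_congr_ae ?_
  filter_upwards [coeFn_laguerreLp hν k] with x hx
  simp [hx]

lemma inner_laguerreLp_eq_laguerreCoeff {ν : ℝ} (hν : -1 < ν) (k : ℕ)
    {g : Lp ℂ 2 (laguerreMeasure ν)} {f : ℝ → ℂ} (h : g =ᵐ[laguerreMeasure ν] f) :
    ⟪laguerreLp hν k, g⟫_ℂ = laguerreCoeff ν f k := by
  have h1 : ⟪laguerreLp hν k, g⟫_ℂ = ∫ x, f x * (laguerreON ν k x : ℂ) ∂laguerreMeasure ν := by
    rw [inner_laguerreLp]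
    refine integral_congr_ae ?_
    filter_upwards [h] with x hx
    rw [hx]
  rw [h1, integral_laguerreMeasure, laguerreCoeff]
  congr 1 with x
  rw [Complex.real_smul, mul_comm]

lemma integral_laguerreON_mul_laguerreON {ν : ℝ} (hν : -1 < ν) (j k : ℕ) (hjk : j ≤ k) :
    ∫ x, laguerreON ν k x * laguerreON ν j x ∂laguerreMeasure ν = if j = k then 1 else 0 := by
  have hG : ∀ i : ℕ, 0 < Real.Gamma (ν + 1 + i) := fun i =>
    Real.Gamma_pos_of_pos (by linarith [i.cast_nonneg (α := ℝ)])
  have hW : meixnerWeight (ν + 1) 1 j * 1 ^ j = Real.Gamma (ν + 1 + j) / j.factorial := by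
    simp [meixnerWeight]
  have h : (fun x => laguerreON ν k x * laguerreON ν j x) = fun x =>
      ∑ i ∈ Finset.range (j + 1), √(Real.Gamma (ν + 1 + j) / j.factorial) *
        (j.choose i / Real.Gamma (ν + 1 + i) * (-1) ^ i) * (laguerreON ν k x * x ^ i) := by
    ext x
    rw [laguerreON_eq hν one_pos j, hW, Finset.mul_sum, Finset.mul_sum]
    refine Finset.sum_congr rfl fun i _ => ?_
    rw [neg_pow]
    ring
  have hint : ∀ i : ℕ, Integrable (fun x => laguerreON ν k x * x ^ i) (laguerreMeasure ν) :=
    fun i => (memLp_laguerreON hν k).integrable_mul (memLp_pow_laguerreMeasure hν i)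
  rw [h, integral_finsetSum _ fun i _ => (hint i).const_mul _]
  simp only [integral_const_mul]
  rw [Finset.sum_range_succ, Finset.sum_eq_zero fun i hi => ?_, zero_add,
    integral_laguerreON_mul_pow hν hjk]
  · split_ifs with h
    · subst h
      have hf : (0 : ℝ) < j.factorial := by positivity
      have h1 : √(Real.Gamma (ν + 1 + j) / j.factorial) * √(j.factorial * Real.Gamma (ν + 1 + j)) =
          Real.Gamma (ν + 1 + j) := by
        rw [← Real.sqrt_mul (by have := hG j; positivity), div_mul_eq_mul_div,
          mul_left_comm, mul_div_cancel_left₀ _ hf.ne', Real.sqrt_mul_self (hG j).le]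
      have h2 : ((-1 : ℝ) ^ j) * (-1) ^ j = 1 := by
        rw [← mul_pow]
        simp
      calc _ = √(Real.Gamma (ν + 1 + j) / j.factorial) * √(j.factorial * Real.Gamma (ν + 1 + j)) *
            (((-1 : ℝ) ^ j) * (-1) ^ j) / Real.Gamma (ν + 1 + j) := by
              rw [Nat.choose_self]
              push_cast
              ring
        _ = 1 := by rw [h1, h2, mul_one, div_self (hG j).ne']
    · simp
  · have hij := Finset.mem_range.mp hi
    rw [integral_laguerreON_mul_pow hν (hij.le.trans hjk), if_neg (by omega), mul_zero]

lemma orthonormal_laguerreLp {ν : ℝ} (hν : -1 < ν) : Orthonormal ℂ (laguerreLp hν) := by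
  have key : ∀ j k, j ≤ k → ⟪laguerreLp hν k, laguerreLp hν j⟫_ℂ = if j = k then 1 else 0 := by
    intro j k hjk
    rw [inner_laguerreLp]
    have h : ∫ x, laguerreLp hν j x * (laguerreON ν k x : ℂ) ∂laguerreMeasure ν =
        ∫ x, ((laguerreON ν k x * laguerreON ν j x : ℝ) : ℂ) ∂laguerreMeasure ν := by
      refine integral_congr_ae ?_
      filter_upwards [coeFn_laguerreLp hν j] with x hx
      rw [hx]
      push_cast
      ring
    rw [h, integral_complex_ofReal, integral_laguerreON_mul_laguerreON hν j k hjk]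
    split_ifs <;> simp
  rw [orthonormal_iff_ite]
  intro j k
  rcases le_total j k with hjk | hjk
  · rw [← inner_conj_symm, key j k hjk]
    split_ifs <;> simp
  · rw [key k j hjk]
    simp [eq_comm]

/-- An element of `L²` orthogonal to all Laguerre polynomials is orthogonal to all monomials. -/
lemma integral_mul_pow_eq_zero_of_inner_laguerreLp {ν : ℝ} (hν : -1 < ν)
    {g : Lp ℂ 2 (laguerreMeasure ν)} (hg : ∀ k, ⟪laguerreLp hν k, g⟫_ℂ = 0) (n : ℕ) :
    ∫ x, g x * ((x ^ n : ℝ) : ℂ) ∂laguerreMeasure ν = 0 := by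
  induction n using Nat.strong_induction_on with
  | _ n ih =>
    set c : ℕ → ℂ := fun i => ((√(meixnerWeight (ν + 1) 1 n * 1 ^ n) *
      (n.choose i / Real.Gamma (ν + 1 + i) * (-1) ^ i) : ℝ) : ℂ) with hc
    have h : (fun x => g x * (laguerreON ν n x : ℂ)) = fun x =>
        ∑ i ∈ Finset.range (n + 1), c i * (g x * ((x ^ i : ℝ) : ℂ)) := by
      ext x
      rw [laguerreON_eq hν one_pos n, Finset.mul_sum]
      push_cast [hc]
      rw [Finset.mul_sum]
      refine Finset.sum_congr rfl fun i _ => ?_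
      rw [neg_pow]
      ring
    have h0 := hg n
    have hint : ∀ i : ℕ, Integrable (fun x => g x * ((x ^ i : ℝ) : ℂ)) (laguerreMeasure ν) :=
      fun i => (Lp.memLp g).integrable_mul (memLp_pow_laguerreMeasure hν i).ofReal
    rw [inner_laguerreLp, h, integral_finsetSum _ fun i _ => (hint i).const_mul (c i)] at h0
    simp only [integral_const_mul] at h0
    rw [Finset.sum_range_succ, Finset.sum_eq_zero fun i hi => by
      rw [ih i (Finset.mem_range.mp hi), mul_zero], zero_add] at h0
    refine (mul_eq_zero.mp h0).resolve_left ?_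
    have hG := Real.Gamma_pos_of_pos (show 0 < ν + 1 + n by linarith [n.cast_nonneg (α := ℝ)])
    have hW := meixnerWeight_pos (β := ν + 1) (by linarith) one_pos n
    simp only [hc, Nat.choose_self]
    exact_mod_cast (by positivity : √(meixnerWeight (ν + 1) 1 n * 1 ^ n) *
      ((1 : ℕ) / Real.Gamma (ν + 1 + n) * (-1) ^ n) ≠ 0)

lemma eq_zero_of_forall_integral_pow_mul_laguerreMeasure {ν : ℝ} (hν : -1 < ν) {g : ℝ → ℝ}
    (hg : MemLp g 2 (laguerreMeasure ν)) (h : ∀ n : ℕ, ∫ x, x ^ n * g x ∂laguerreMeasure ν = 0) :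
    g =ᵐ[laguerreMeasure ν] 0 := by
  refine ae_eq_zero_of_forall_integral_pow_mul_eq_zero (δ := 1 / 2) (by norm_num)
    (fun t ht => ?_) h
  have hexp : MemLp (fun x => Real.exp (t * x)) 2 (laguerreMeasure ν) := by
    rw [memLp_two_iff_integrable_sq (by fun_prop)]
    refine (integrable_pow_mul_exp_laguerreMeasure hν 0 (t := 2 * t)
      (by linarith [ht.2])).congr (Filter.Eventually.of_forall fun x => ?_)
    simp only [pow_zero, one_mul, ← Real.exp_nat_mul]
    push_cast
    ring_nf
  exact hexp.integrable_mul hg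

/-- The orthonormal Laguerre polynomials as a Hilbert basis of `L²(x ^ ν * e ^ (-x) dx)`. -/
lemma exists_hilbertBasis_laguerreLp {ν : ℝ} (hν : -1 < ν) :
    ∃ b : HilbertBasis ℕ ℂ (Lp ℂ 2 (laguerreMeasure ν)), ∀ k, b k = laguerreLp hν k := by
  have horth : (Submodule.span ℂ (Set.range (laguerreLp hν)))ᗮ = ⊥ := by
    rw [Submodule.eq_bot_iff]
    intro g hg
    have hg0 := integral_mul_pow_eq_zero_of_inner_laguerreLp hν fun k =>
      (Submodule.mem_orthogonal _ g).mp hg _ (Submodule.subset_span ⟨k, rfl⟩)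
    have hint : ∀ n : ℕ, Integrable (fun x => g x * ((x ^ n : ℝ) : ℂ)) (laguerreMeasure ν) :=
      fun n => (Lp.memLp g).integrable_mul (memLp_pow_laguerreMeasure hν n).ofReal
    have hre := eq_zero_of_forall_integral_pow_mul_laguerreMeasure hν (Lp.memLp g).re fun n => by
      have h := integral_re (hint n)
      rw [hg0 n] at h
      simpa [mul_comm, -Complex.ofReal_pow] using h
    have him := eq_zero_of_forall_integral_pow_mul_laguerreMeasure hν (Lp.memLp g).im fun n => by
      have h := integral_im (hint n)
      rw [hg0 n] at h
      simpa [mul_comm, -Complex.ofReal_pow] using h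
    refine Lp.ext ?_
    filter_upwards [hre, him, Lp.coeFn_zero ℂ 2 (laguerreMeasure ν)] with x h1 h2 h3
    rw [h3]
    exact Complex.ext h1 h2
  exact ⟨HilbertBasis.mkOfOrthogonalEqBot (orthonormal_laguerreLp hν) horth, fun k => by
    rw [HilbertBasis.coe_mkOfOrthogonalEqBot]⟩

/-! ### Power moments of the Macdonald function -/

lemma lintegral_Iio_eq_lintegral_Ioi_neg (g : ℝ → ENNReal) :
    ∫⁻ t in Iio (0 : ℝ), g t = ∫⁻ t in Ioi (0 : ℝ), g (-t) := by
  have h := lintegral_image_eq_lintegral_abs_deriv_mul (s := Ioi (0 : ℝ)) (f := fun t : ℝ => -t)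
    (f' := fun _ => -1) measurableSet_Ioi (fun x _ => (hasDerivAt_neg x).hasDerivWithinAt)
    neg_injective.injOn g
  simpa using h

/-- The integral defining the Macdonald function, as an integral over the whole line. -/
lemma two_mul_lintegral_exp_neg_mul_cosh (ν x : ℝ) :
    2 * ∫⁻ t in Ioi (0 : ℝ), ENNReal.ofReal (Real.exp (-x * Real.cosh t) * Real.cosh (ν * t)) =
      ∫⁻ t, ENNReal.ofReal (Real.exp (-x * Real.cosh t) * Real.exp (ν * t)) := by
  rw [← lintegral_add_compl (fun t => ENNReal.ofReal (Real.exp (-x * Real.cosh t) *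
      Real.exp (ν * t))) (measurableSet_Ioi (a := (0 : ℝ))), compl_Ioi,
    setLIntegral_congr Iio_ae_eq_Iic.symm, lintegral_Iio_eq_lintegral_Ioi_neg,
    ← lintegral_add_left (by fun_prop), ← lintegral_const_mul _ (by fun_prop)]
  refine lintegral_congr fun t => ?_
  rw [← ENNReal.ofReal_add (by positivity) (by positivity),
    show (2 : ENNReal) = ENNReal.ofReal 2 by simp, ← ENNReal.ofReal_mul (by norm_num),
    Real.cosh_neg, ← mul_add, Real.cosh_eq (ν * t)]
  congr 1
  rw [mul_neg]
  ring

/-- The substitution `t = log (2 * τ / x)`. -/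
lemma lintegral_exp_neg_mul_cosh_mul_exp (ν : ℝ) {x : ℝ} (hx : 0 < x) :
    ∫⁻ t, ENNReal.ofReal (Real.exp (-x * Real.cosh t) * Real.exp (ν * t)) =
      ∫⁻ τ in Ioi (0 : ℝ), ENNReal.ofReal
        (τ⁻¹ * (2 * τ / x) ^ ν * Real.exp (-τ) * Real.exp (-(x ^ 2 / (4 * τ)))) := by
  have hpos : ∀ τ ∈ Ioi (0 : ℝ), 0 < 2 * τ / x := fun τ hτ => by
    have := mem_Ioi.mp hτ
    positivity
  have himage : (fun τ => Real.log (2 * τ / x)) '' Ioi 0 = univ := by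
    refine eq_univ_of_forall fun t => ⟨x * Real.exp t / 2, ?_, ?_⟩
    · have := Real.exp_pos t
      exact mem_Ioi.mpr (by positivity)
    · simp only
      rw [show 2 * (x * Real.exp t / 2) / x = Real.exp t by field_simp, Real.log_exp]
  have hinj : InjOn (fun τ => Real.log (2 * τ / x)) (Ioi 0) := by
    intro τ hτ σ hσ h
    have h1 := Real.log_injOn_pos (hpos τ hτ) (hpos σ hσ) h
    field_simp at h1
    exact h1
  have hderiv : ∀ τ ∈ Ioi (0 : ℝ),
      HasDerivWithinAt (fun τ => Real.log (2 * τ / x)) τ⁻¹ (Ioi 0) τ := by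
    intro τ hτ
    have h := (((hasDerivAt_id τ).const_mul 2).div_const x).log (hpos τ hτ).ne'
    have hτ' := (mem_Ioi.mp hτ).ne'
    have h1 : 2 * 1 / x / (2 * id τ / x) = τ⁻¹ := by
      simp only [id]
      field_simp
    rw [h1] at h
    exact h.hasDerivWithinAt
  have h := lintegral_image_eq_lintegral_abs_deriv_mul measurableSet_Ioi hderiv hinj
    fun t => ENNReal.ofReal (Real.exp (-x * Real.cosh t) * Real.exp (ν * t))
  rw [himage, setLIntegral_univ] at h
  rw [h]
  refine setLIntegral_congr_fun measurableSet_Ioi fun τ hτ => ?_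
  have hτ' := mem_Ioi.mp hτ
  rw [abs_of_pos (by positivity : 0 < τ⁻¹), ← ENNReal.ofReal_mul (by positivity),
    Real.cosh_log (hpos τ hτ), mul_comm ν, ← Real.rpow_def_of_pos (hpos τ hτ),
    show -x * ((2 * τ / x + (2 * τ / x)⁻¹) / 2) = -τ + -(x ^ 2 / (4 * τ)) by field_simp; ring,
    Real.exp_add]
  congr 1
  ring

lemma lintegral_pow_mul_exp_neg_mul_sq (n : ℕ) {b : ℝ} (hb : 0 < b) :
    ∫⁻ r in Ioi (0 : ℝ), ENNReal.ofReal (r ^ (2 * n + 1) * Real.exp (-(b * r ^ 2))) =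
      ENNReal.ofReal (n.factorial / (2 * b ^ (n + 1))) := by
  have hq : (-1 : ℝ) < (2 * n + 1 : ℕ) := by
    push_cast
    linarith [n.cast_nonneg (α := ℝ)]
  have hint := integrableOn_rpow_mul_exp_neg_mul_rpow (p := 2) hq two_pos hb
  have hval := integral_rpow_mul_exp_neg_mul_rpow (p := 2) two_pos hq hb
  simp only [Real.rpow_natCast, Real.rpow_two, neg_mul] at hint hval
  rw [← ofReal_integral_eq_lintegral_ofReal hint, hval]
  · congr 1
    rw [show (((2 * n + 1 : ℕ) : ℝ) + 1) / 2 = (n : ℝ) + 1 by push_cast; ring,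
      show -(((2 * n + 1 : ℕ) : ℝ) + 1) / 2 = -((n + 1 : ℕ) : ℝ) by push_cast; ring,
      Real.Gamma_nat_eq_factorial, Real.rpow_neg hb.le, Real.rpow_natCast]
    field_simp
  · filter_upwards [ae_restrict_mem measurableSet_Ioi] with r hr
    have := mem_Ioi.mp hr
    simp only [Pi.zero_apply]
    positivity

lemma lintegral_rpow_mul_exp_neg {s : ℝ} (hs : -1 < s) :
    ∫⁻ τ in Ioi (0 : ℝ), ENNReal.ofReal (τ ^ s * Real.exp (-τ)) =
      ENNReal.ofReal (Real.Gamma (s + 1)) := by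
  have hint := integrableOn_rpow_mul_exp_neg_mul_rpow (p := 1) hs one_pos one_pos
  simp only [Real.rpow_one, neg_mul, one_mul] at hint
  rw [← ofReal_integral_eq_lintegral_ofReal hint, Real.Gamma_eq_integral (by linarith)]
  · congr 1
    refine integral_congr_ae (Filter.Eventually.of_forall fun τ => ?_)
    simp only
    rw [add_sub_cancel_right, mul_comm]
  · filter_upwards [ae_restrict_mem measurableSet_Ioi] with r hr
    have := mem_Ioi.mp hr
    simp only [Pi.zero_apply]
    positivity

/-- The `n`-th even moment of `r ^ ν * K_ν (c * r) * r`, up to the angular factor `2 * π`. -/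
noncomputable def macdonaldMoment (ν c : ℝ) (n : ℕ) : ℝ :=
  (2 / c) ^ (ν + 2) * ((2 / c) ^ 2) ^ n * (n.factorial * Real.Gamma (ν + 1 + n)) / 4

/-- The moments of the Macdonald function, with the integral defining it taken in `[0, ∞]`. -/
lemma lintegral_rpow_mul_lintegral_exp_neg_mul_cosh {ν c : ℝ} (hν : -1 < ν) (hc : 0 < c) (n : ℕ) :
    ∫⁻ r in Ioi (0 : ℝ), ENNReal.ofReal (r ^ ν * r ^ (2 * n + 1)) *
        ∫⁻ t in Ioi (0 : ℝ),
          ENNReal.ofReal (Real.exp (-(c * r) * Real.cosh t) * Real.cosh (ν * t)) =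
      ENNReal.ofReal (macdonaldMoment ν c n) := by
  have h2 : ∀ a b : ENNReal, 2 * a = b → a = ENNReal.ofReal 2⁻¹ * b := by
    rintro a _ rfl
    rw [← mul_assoc, show (2 : ENNReal) = ENNReal.ofReal 2 by simp,
      ← ENNReal.ofReal_mul (by norm_num)]
    norm_num
  have hint : ∀ r ∈ Ioi (0 : ℝ), ENNReal.ofReal (r ^ ν * r ^ (2 * n + 1)) *
      ∫⁻ t in Ioi (0 : ℝ),
        ENNReal.ofReal (Real.exp (-(c * r) * Real.cosh t) * Real.cosh (ν * t)) =
      ∫⁻ τ in Ioi (0 : ℝ), ENNReal.ofReal (2⁻¹ * (τ⁻¹ * (2 * τ / c) ^ ν * Real.exp (-τ))) *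
        ENNReal.ofReal (r ^ (2 * n + 1) * Real.exp (-(c ^ 2 / (4 * τ) * r ^ 2))) := by
    intro r hr
    have hr' := mem_Ioi.mp hr
    rw [h2 _ _ (two_mul_lintegral_exp_neg_mul_cosh ν (c * r)),
      lintegral_exp_neg_mul_cosh_mul_exp ν (by positivity),
      ← lintegral_const_mul _ (by fun_prop), ← lintegral_const_mul _ (by fun_prop)]
    refine setLIntegral_congr_fun measurableSet_Ioi fun τ hτ => ?_
    have hτ' := mem_Ioi.mp hτ
    have hsplit : (2 * τ / (c * r)) ^ ν * r ^ ν = (2 * τ / c) ^ ν := by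
      rw [← Real.mul_rpow (by positivity) hr'.le]
      congr 1
      field_simp
    rw [← ENNReal.ofReal_mul (by norm_num), ← ENNReal.ofReal_mul (by positivity),
      ← ENNReal.ofReal_mul (by positivity), ← hsplit,
      show c ^ 2 / (4 * τ) * r ^ 2 = (c * r) ^ 2 / (4 * τ) by ring]
    congr 1
    ring
  rw [setLIntegral_congr_fun measurableSet_Ioi hint,
    lintegral_lintegral_swap (by fun_prop)]
  have hint2 : ∀ τ ∈ Ioi (0 : ℝ), ∫⁻ r in Ioi (0 : ℝ),
      ENNReal.ofReal (2⁻¹ * (τ⁻¹ * (2 * τ / c) ^ ν * Real.exp (-τ))) *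
        ENNReal.ofReal (r ^ (2 * n + 1) * Real.exp (-(c ^ 2 / (4 * τ) * r ^ 2))) =
      ENNReal.ofReal ((2 / c) ^ (ν + 2) * ((2 / c) ^ 2) ^ n * n.factorial / 4) *
        ENNReal.ofReal (τ ^ (ν + n) * Real.exp (-τ)) := by
    intro τ hτ
    have hτ' := mem_Ioi.mp hτ
    rw [lintegral_const_mul _ (by fun_prop), lintegral_pow_mul_exp_neg_mul_sq n (by positivity),
      ← ENNReal.ofReal_mul (by positivity), ← ENNReal.ofReal_mul (by positivity)]
    congr 1
    rw [Real.rpow_add hτ', Real.rpow_add (by positivity : 0 < 2 / c), Real.rpow_natCast,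
      Real.rpow_two, show 2 * τ / c = τ * (2 / c) by ring, Real.mul_rpow hτ'.le (by positivity),
      show c ^ 2 / (4 * τ) = (τ * (2 / c) ^ 2)⁻¹ by field_simp; norm_num, inv_pow, mul_pow, pow_succ,
      pow_succ _ n]
    field_simp
    norm_num
  rw [setLIntegral_congr_fun measurableSet_Ioi hint2, lintegral_const_mul _ (by fun_prop),
    lintegral_rpow_mul_exp_neg (by linarith [n.cast_nonneg (α := ℝ)]),
    ← ENNReal.ofReal_mul (by positivity), macdonaldMoment, add_right_comm]
  congr 1
  ring

lemma macdonaldK_nonneg (ν x : ℝ) : 0 ≤ macdonaldK ν x :=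
  integral_nonneg fun t => by
    have := Real.cosh_pos (ν * t)
    simp only [Pi.zero_apply]
    positivity

lemma measurable_macdonaldK (ν : ℝ) : Measurable (macdonaldK ν) := by
  unfold macdonaldK
  refine StronglyMeasurable.measurable (StronglyMeasurable.integral_prod_right ?_)
  exact Measurable.stronglyMeasurable (by fun_prop)

/-- Finiteness of a moment shows that the integral defining `K_ν (c * r)` converges for almost every
`r`. -/
lemma ofReal_macdonaldK_ae_eq {ν c : ℝ} (hν : -1 < ν) (hc : 0 < c) :
    ∀ᵐ r ∂volume.restrict (Ioi (0 : ℝ)), ENNReal.ofReal (macdonaldK ν (c * r)) =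
      ∫⁻ t in Ioi (0 : ℝ),
        ENNReal.ofReal (Real.exp (-(c * r) * Real.cosh t) * Real.cosh (ν * t)) := by
  have hfin := lintegral_rpow_mul_lintegral_exp_neg_mul_cosh hν hc 0
  have hmeas : Measurable fun r : ℝ => ∫⁻ t in Ioi (0 : ℝ),
      ENNReal.ofReal (Real.exp (-(c * r) * Real.cosh t) * Real.cosh (ν * t)) :=
    Measurable.lintegral_prod_right' (f := fun p : ℝ × ℝ =>
      ENNReal.ofReal (Real.exp (-(c * p.1) * Real.cosh p.2) * Real.cosh (ν * p.2))) (by fun_prop)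
  have hlt := ae_lt_top (Measurable.mul (by fun_prop) hmeas) (hfin.trans_ne ENNReal.ofReal_ne_top)
  filter_upwards [hlt, ae_restrict_mem measurableSet_Ioi] with r h1 hr
  have hr' := mem_Ioi.mp hr
  have h2 : ∫⁻ t in Ioi (0 : ℝ),
      ENNReal.ofReal (Real.exp (-(c * r) * Real.cosh t) * Real.cosh (ν * t)) ≠ ⊤ := by
    intro htop
    rw [Pi.mul_apply, htop, ENNReal.mul_top] at h1
    · exact lt_irrefl _ h1
    · rw [ne_eq, ENNReal.ofReal_eq_zero, not_le]
      positivity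
  rw [macdonaldK, integral_eq_lintegral_of_nonneg_ae, ENNReal.ofReal_toReal h2]
  · refine Filter.Eventually.of_forall fun t => ?_
    have := Real.cosh_pos (ν * t)
    simp only [Pi.zero_apply]
    positivity
  · exact Measurable.aestronglyMeasurable (by fun_prop)

lemma lintegral_rpow_mul_macdonaldK {ν c : ℝ} (hν : -1 < ν) (hc : 0 < c) (n : ℕ) :
    ∫⁻ r in Ioi (0 : ℝ), ENNReal.ofReal (r ^ ν * r ^ (2 * n + 1) * macdonaldK ν (c * r)) =
      ENNReal.ofReal (macdonaldMoment ν c n) := by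
  rw [← lintegral_rpow_mul_lintegral_exp_neg_mul_cosh hν hc n]
  refine lintegral_congr_ae ?_
  filter_upwards [ofReal_macdonaldK_ae_eq hν hc, ae_restrict_mem measurableSet_Ioi] with r h1 hr
  have hr' := mem_Ioi.mp hr
  rw [ENNReal.ofReal_mul (by positivity), h1]

/-! ### Weighted norms of entire functions in terms of their power series -/

lemma integral_Ioo_exp_int_mul (k : ℤ) :
    ∫ φ in Ioo (-Real.pi) Real.pi, Complex.exp (k * Complex.I * φ) =
      if k = 0 then ((2 * Real.pi : ℝ) : ℂ) else 0 := by
  have hpi := Real.pi_pos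
  rw [← integral_Ioc_eq_integral_Ioo, ← intervalIntegral.integral_of_le (by linarith)]
  split_ifs with hk
  · subst hk
    simp
    ring
  · have hc : (k : ℂ) * Complex.I ≠ 0 := mul_ne_zero (by exact_mod_cast hk) Complex.I_ne_zero
    rw [integral_exp_mul_complex hc, div_eq_zero_iff, sub_eq_zero]
    left
    rw [Complex.exp_eq_exp_iff_exists_int]
    exact ⟨k, by push_cast; ring⟩

/-- Parseval's identity for an absolutely convergent series. -/
lemma lintegral_norm_tsum_mul_exp_sq {a : ℕ → ℂ} (ha : Summable fun n => ‖a n‖) :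
    ∫⁻ φ in Ioo (-Real.pi) Real.pi,
        ENNReal.ofReal (‖∑' n : ℕ, a n * Complex.exp (n * Complex.I * φ)‖ ^ 2) =
      ENNReal.ofReal (2 * Real.pi) * ∑' n, ENNReal.ofReal (‖a n‖ ^ 2) := by
  have hnorm : ∀ (k : ℤ) (φ : ℝ), ‖Complex.exp (k * Complex.I * φ)‖ = 1 := by
    intro k φ
    rw [show (k : ℂ) * Complex.I * φ = ((k * φ : ℝ) : ℂ) * Complex.I by push_cast; ring]
    exact Complex.norm_exp_ofReal_mul_I _
  have hnorm' : ∀ (n : ℕ) (φ : ℝ), ‖Complex.exp (n * Complex.I * φ)‖ = 1 := fun n φ => by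
    simpa using hnorm n φ
  -- the terms of the double series for the squared modulus, whose integrals vanish off the diagonal
  set F : ℕ × ℕ → ℝ → ℂ := fun p φ =>
    a p.1 * conj (a p.2) * Complex.exp (((p.1 : ℤ) - (p.2 : ℤ) : ℤ) * Complex.I * φ) with hF
  set μ := volume.restrict (Ioo (-Real.pi) Real.pi) with hμ
  have hFnorm : ∀ p φ, ‖F p φ‖ = ‖a p.1‖ * ‖a p.2‖ := fun p φ => by
    rw [hF]
    simp only [norm_mul, hnorm, mul_one, RCLike.norm_conj]
  have hprod : Summable fun p : ℕ × ℕ => ‖a p.1‖ * ‖a p.2‖ :=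
    ha.mul_of_nonneg ha (fun _ => norm_nonneg _) fun _ => norm_nonneg _
  have hFint : ∀ p, Integrable (F p) μ := fun p =>
    (integrable_const (‖a p.1‖ * ‖a p.2‖)).mono' (by
      rw [hF]
      exact Continuous.aestronglyMeasurable (by fun_prop))
      (Filter.Eventually.of_forall fun φ => (hFnorm p φ).le)
  have hFsum : Summable fun p => ∫ φ, ‖F p φ‖ ∂μ := by
    simp only [hFnorm, integral_const, smul_eq_mul]
    exact hprod.mul_left _
  have hsum := hasSum_integral_of_summable_integral_norm hFint hFsum
  have hval : ∀ p, ∫ φ, F p φ ∂μ =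
      if p.2 = p.1 then ((2 * Real.pi * ‖a p.1‖ ^ 2 : ℝ) : ℂ) else 0 := by
    intro p
    simp only [hF]
    rw [integral_const_mul, integral_Ioo_exp_int_mul]
    by_cases h : p.2 = p.1
    · rw [if_pos (by rw [h, sub_self]), if_pos h, h, Complex.mul_conj, Complex.normSq_eq_norm_sq]
      push_cast
      ring
    · rw [if_neg (by omega), if_neg h, mul_zero]
  have hdiag : HasSum (fun n => ((2 * Real.pi * ‖a n‖ ^ 2 : ℝ) : ℂ))
      (∫ φ, ∑' p, F p φ ∂μ) := by
    simp only [hval] at hsum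
    exact hsum.prod_fiberwise fun n => hasSum_ite_eq n _
  have hsq : ∀ φ : ℝ, ∑' p, F p φ =
      ((‖∑' n : ℕ, a n * Complex.exp (n * Complex.I * φ)‖ ^ 2 : ℝ) : ℂ) := by
    intro φ
    have hs : Summable fun n : ℕ => ‖a n * Complex.exp (n * Complex.I * φ)‖ := by
      simpa only [norm_mul, hnorm', mul_one] using ha
    have hs' : Summable fun n : ℕ => ‖conj (a n * Complex.exp (n * Complex.I * φ))‖ := by
      simpa only [RCLike.norm_conj] using hs
    rw [← Complex.normSq_eq_norm_sq, ← Complex.mul_conj, Complex.conj_tsum,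
      tsum_mul_tsum_of_summable_norm hs hs']
    refine tsum_congr fun p => ?_
    simp only [hF, map_mul, ← Complex.exp_conj, Complex.conj_I, Complex.conj_ofReal, map_natCast]
    rw [mul_mul_mul_comm, ← Complex.exp_add]
    congr 2
    push_cast
    ring
  simp only [hsq] at hdiag
  rw [integral_complex_ofReal, Complex.hasSum_ofReal] at hdiag
  have hbound : ∀ φ : ℝ, ‖∑' n : ℕ, a n * Complex.exp (n * Complex.I * φ)‖ ≤ ∑' n, ‖a n‖ := by
    intro φ
    refine (norm_tsum_le_tsum_norm ?_).trans (le_of_eq ?_)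
    · simpa only [norm_mul, hnorm', mul_one] using ha
    · simp only [norm_mul, hnorm', mul_one]
  have hcont : Continuous fun φ : ℝ => ∑' n : ℕ, a n * Complex.exp (n * Complex.I * φ) :=
    continuous_tsum (fun n => by fun_prop) ha fun n φ => by rw [norm_mul, hnorm', mul_one]
  have hint : Integrable
      (fun φ : ℝ => ‖∑' n : ℕ, a n * Complex.exp (n * Complex.I * φ)‖ ^ 2) μ :=
    (integrable_const ((∑' n, ‖a n‖) ^ 2)).mono' (hcont.norm.pow 2).aestronglyMeasurable
      (Filter.Eventually.of_forall fun φ => by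
        rw [Real.norm_of_nonneg (by positivity)]
        gcongr
        exact hbound φ)
  rw [← ofReal_integral_eq_lintegral_ofReal hint
    (Filter.Eventually.of_forall fun φ => by simp only [Pi.zero_apply]; positivity),
    ← hdiag.tsum_eq, ENNReal.ofReal_tsum_of_nonneg (fun n => by positivity) hdiag.summable,
    ← ENNReal.tsum_mul_left]
  refine tsum_congr fun n => ?_
  rw [ENNReal.ofReal_mul (by positivity)]

/-- The squared norm of an entire function with respect to a radial weight is a weighted sum of
the squares of its Taylor coefficients, the weights being the moments of the radial weight. -/
lemma lintegral_norm_sq_mul_radial {ω : ℝ → ℝ} (hω : Measurable ω) (hω0 : ∀ r, 0 < r → 0 ≤ ω r)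
    {G : ℂ → ℂ} {h : ℕ → ℂ} (hG : ∀ z, HasSum (fun n => h n * z ^ n) (G z)) (hGm : Measurable G) :
    ∫⁻ z, ENNReal.ofReal (‖G z‖ ^ 2 * ω ‖z‖) =
      ∑' n, ENNReal.ofReal (2 * Real.pi * ‖h n‖ ^ 2) *
        ∫⁻ r in Ioi (0 : ℝ), ENNReal.ofReal (r ^ (2 * n + 1) * ω r) := by
  have hsymm : Measurable fun p : ℝ × ℝ =>
      (p.1 : ℂ) * (Real.cos p.2 + Real.sin p.2 * Complex.I) := by
    fun_prop
  rw [← Complex.lintegral_comp_polarCoord_symm]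
  have hnorm : ∀ p : ℝ × ℝ, ‖(p.1 : ℂ) * (Real.cos p.2 + Real.sin p.2 * Complex.I)‖ = |p.1| :=
    fun p => by rw [← Complex.polarCoord_symm_apply, Complex.norm_polarCoord_symm]
  simp only [Complex.polarCoord_symm_apply, smul_eq_mul, hnorm]
  rw [polarCoord_target, Measure.volume_eq_prod, ← Measure.prod_restrict, lintegral_prod _ (by
    refine Measurable.aemeasurable (Measurable.mul measurable_fst.ennreal_ofReal ?_)
    exact (((hGm.comp hsymm).norm.pow_const 2).mul (hω.comp (by fun_prop))).ennreal_ofReal)]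
  have hinner : ∀ r ∈ Ioi (0 : ℝ), ∫⁻ φ in Ioo (-Real.pi) Real.pi, ENNReal.ofReal r *
      ENNReal.ofReal (‖G ((r : ℂ) * (Real.cos φ + Real.sin φ * Complex.I))‖ ^ 2 * ω |r|) =
      ∑' n, ENNReal.ofReal (2 * Real.pi * ‖h n‖ ^ 2) *
        ENNReal.ofReal (r ^ (2 * n + 1) * ω r) := by
    intro r hr
    have hr' := mem_Ioi.mp hr
    have hωr := hω0 r hr'
    have hsum : Summable fun n => ‖h n * (r : ℂ) ^ n‖ := (hG r).summable.norm
    have hGr : ∀ φ : ℝ, G ((r : ℂ) * (Real.cos φ + Real.sin φ * Complex.I)) =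
        ∑' n : ℕ, h n * (r : ℂ) ^ n * Complex.exp (n * Complex.I * φ) := by
      intro φ
      rw [← (hG _).tsum_eq]
      refine tsum_congr fun n => ?_
      rw [mul_pow, ← mul_assoc, Complex.ofReal_cos, Complex.ofReal_sin, ← Complex.exp_mul_I,
        ← Complex.exp_nat_mul]
      congr 2
      ring
    have hterm : ∀ φ : ℝ, ENNReal.ofReal r *
        ENNReal.ofReal (‖G ((r : ℂ) * (Real.cos φ + Real.sin φ * Complex.I))‖ ^ 2 * ω |r|) =
        ENNReal.ofReal (r * ω r) * ENNReal.ofReal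
          (‖∑' n : ℕ, h n * (r : ℂ) ^ n * Complex.exp (n * Complex.I * φ)‖ ^ 2) := by
      intro φ
      rw [hGr, abs_of_pos hr', ← ENNReal.ofReal_mul hr'.le, ← ENNReal.ofReal_mul (by positivity)]
      congr 1
      ring
    simp only [hterm]
    rw [lintegral_const_mul' _ _ ENNReal.ofReal_ne_top, lintegral_norm_tsum_mul_exp_sq hsum,
      ← mul_assoc, ← ENNReal.tsum_mul_left]
    refine tsum_congr fun n => ?_
    have hpi := Real.pi_pos
    rw [← ENNReal.ofReal_mul (by positivity), ← ENNReal.ofReal_mul (by positivity),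
      ← ENNReal.ofReal_mul (by positivity)]
    congr 1
    rw [norm_mul, norm_pow, Complex.norm_of_nonneg hr'.le]
    ring
  rw [setLIntegral_congr_fun measurableSet_Ioi hinner, lintegral_tsum fun n => by fun_prop]
  refine tsum_congr fun n => ?_
  rw [lintegral_const_mul _ (by fun_prop)]

lemma lintegral_norm_sq_mul_rpow_mul_macdonaldK {ν c : ℝ} (hν : -1 < ν) (hc : 0 < c)
    {G : ℂ → ℂ} {h : ℕ → ℂ} (hG : ∀ z, HasSum (fun n => h n * z ^ n) (G z)) (hGm : Measurable G) :
    ∫⁻ z, ENNReal.ofReal (‖G z‖ ^ 2 * (‖z‖ ^ ν * macdonaldK ν (c * ‖z‖))) =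
      ∑' n, ENNReal.ofReal (2 * Real.pi * ‖h n‖ ^ 2 * macdonaldMoment ν c n) := by
  have hm := measurable_macdonaldK ν
  rw [lintegral_norm_sq_mul_radial (ω := fun r => r ^ ν * macdonaldK ν (c * r)) (by fun_prop)
    (fun r hr => mul_nonneg (Real.rpow_nonneg hr.le _) (macdonaldK_nonneg _ _)) hG hGm]
  refine tsum_congr fun n => ?_
  have hpi := Real.pi_pos
  rw [ENNReal.ofReal_mul (by positivity : 0 ≤ 2 * Real.pi * ‖h n‖ ^ 2),
    ← lintegral_rpow_mul_macdonaldK hν hc n]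
  congr 2
  ext r
  congr 1
  ring

lemma tsum_ofReal_ne_top_iff {a : ℕ → ℝ} (ha : ∀ n, 0 ≤ a n) :
    ∑' n, ENNReal.ofReal (a n) ≠ ⊤ ↔ Summable a := by
  refine ⟨fun h => ?_, Summable.tsum_ofReal_ne_top⟩
  have h1 := ENNReal.tsum_coe_ne_top_iff_summable.mp h
  refine (NNReal.summable_coe.mpr h1).congr fun n => Real.coe_toNNReal _ (ha n)

lemma memℓp_two_iff {u : ℕ → ℂ} : Memℓp u 2 ↔ Summable fun n => ‖u n‖ ^ 2 := by
  rw [memℓp_gen_iff (by norm_num)]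
  simp

lemma macdonaldMoment_eq {ν θ : ℝ} (hν : -1 < ν) (hθ : 1 < θ) (n : ℕ) :
    macdonaldMoment ν (2 * √θ / (θ - 1)) n =
      ((θ - 1) / √θ) ^ (ν + 2) / 4 * (fockCoeff (ν + 1) θ n ^ 2)⁻¹ := by
  have hθ0 : 0 < θ := by positivity
  have h1 : 2 / (2 * √θ / (θ - 1)) = (θ - 1) / √θ := by
    rw [div_div_eq_mul_div, mul_div_mul_left _ _ two_ne_zero]
  rw [macdonaldMoment, inv_fockCoeff_sq (by linarith) hθ, h1, div_pow (θ - 1) √θ 2,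
    Real.sq_sqrt hθ0.le]
  ring

/-- The weighted integral of an entire function is finite precisely when, up to the factor
`exp (z / (θ - 1))`, the function is represented by a vector of `ℓ²`. -/
lemma integrable_iff_exists_inner_fockKernel {ν θ : ℝ} (hβ : 0 < ν + 1) (hθ : 1 < θ) {F : ℂ → ℂ}
    (hF : Differentiable ℂ F) :
    Integrable (fun z : ℂ => ‖F z‖ ^ 2 * Real.exp (2 * z.re / (θ - 1)) * ‖z‖ ^ ν *
        macdonaldK ν (2 * Real.sqrt θ * ‖z‖ / (θ - 1))) volume ↔
      ∃ u : ℓ²(ℕ, ℂ), ∀ z, Complex.exp (z / (θ - 1)) * F z = ⟪fockKernel hβ hθ z, u⟫_ℂ := by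
  have hθ1 : 0 < θ - 1 := sub_pos.mpr hθ
  have hθ0 : 0 < θ := by positivity
  have hc : 0 < 2 * √θ / (θ - 1) := by positivity
  have hK := measurable_macdonaldK ν
  have hFm : Measurable F := hF.continuous.measurable
  set G : ℂ → ℂ := fun z => Complex.exp (z / (θ - 1)) * F z with hGdef
  have hGd : Differentiable ℂ G := by fun_prop
  have hGnorm : ∀ z, ‖F z‖ ^ 2 * Real.exp (2 * z.re / (θ - 1)) * ‖z‖ ^ ν *
      macdonaldK ν (2 * Real.sqrt θ * ‖z‖ / (θ - 1)) =
      ‖G z‖ ^ 2 * (‖z‖ ^ ν * macdonaldK ν (2 * √θ / (θ - 1) * ‖z‖)) := by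
    intro z
    have h1 : ‖Complex.exp (z / (θ - 1))‖ ^ 2 = Real.exp (2 * z.re / (θ - 1)) := by
      rw [Complex.norm_exp, ← Real.exp_nat_mul, show z / ((θ : ℂ) - 1) = z / ((θ - 1 : ℝ) : ℂ) by
        push_cast; rfl, Complex.div_ofReal_re]
      congr 1
      push_cast
      ring
    rw [hGdef]
    simp only [norm_mul, mul_pow]
    rw [h1, show 2 * √θ / (θ - 1) * ‖z‖ = 2 * √θ * ‖z‖ / (θ - 1) by ring]
    ring
  have hcoef : ∀ h : ℕ → ℂ, (∀ z, HasSum (fun n => h n * z ^ n) (G z)) →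
      (Integrable (fun z : ℂ => ‖F z‖ ^ 2 * Real.exp (2 * z.re / (θ - 1)) * ‖z‖ ^ ν *
        macdonaldK ν (2 * Real.sqrt θ * ‖z‖ / (θ - 1))) volume ↔
      Memℓp (fun n => h n / fockCoeff (ν + 1) θ n) 2) := by
    intro h hh
    rw [← lintegral_ofReal_ne_top_iff_integrable (Measurable.aestronglyMeasurable (by fun_prop))
      (Filter.Eventually.of_forall fun z => by
        have := macdonaldK_nonneg ν (2 * Real.sqrt θ * ‖z‖ / (θ - 1))
        simp only [Pi.zero_apply]
        positivity)]
    simp only [hGnorm]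
    have hpi := Real.pi_pos
    have hC : 0 < 2 * Real.pi * (((θ - 1) / √θ) ^ (ν + 2) / 4) := by positivity
    have hterm : ∀ n, 2 * Real.pi * ‖h n‖ ^ 2 * macdonaldMoment ν (2 * √θ / (θ - 1)) n =
        2 * Real.pi * (((θ - 1) / √θ) ^ (ν + 2) / 4) *
          ‖h n / fockCoeff (ν + 1) θ n‖ ^ 2 := by
      intro n
      rw [macdonaldMoment_eq (by linarith) hθ, norm_div,
        Complex.norm_of_nonneg (fockCoeff_pos hβ hθ n).le, div_pow]
      ring
    rw [lintegral_norm_sq_mul_rpow_mul_macdonaldK (by linarith) hc hh hGd.continuous.measurable]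
    simp only [hterm]
    rw [tsum_ofReal_ne_top_iff fun n => by positivity, summable_mul_left_iff hC.ne', memℓp_two_iff]
  have hg : ∀ n, (fockCoeff (ν + 1) θ n : ℂ) ≠ 0 := fun n => by
    exact_mod_cast (fockCoeff_pos hβ hθ n).ne'
  constructor
  · intro hint
    have htaylor : ∀ z, HasSum (fun n : ℕ => (n.factorial : ℂ)⁻¹ * iteratedDeriv n G 0 * z ^ n)
        (G z) := fun z =>
      (Complex.hasSum_taylorSeries_of_entire hGd 0 z).of_eq (fun n => by
        simp only [smul_eq_mul, sub_zero]
        ring) rfl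
    refine ⟨⟨_, (hcoef _ htaylor).mp hint⟩, fun z => (htaylor z).unique ?_⟩
    refine (hasSum_inner_fockKernel hβ hθ z _).of_eq (fun n => ?_) rfl
    simp only
    rw [div_mul_cancel₀ _ (hg n)]
  · rintro ⟨u, hu⟩
    refine (hcoef (fun n => u n * fockCoeff (ν + 1) θ n) fun z => ?_).mpr ?_
    · rw [hGdef]
      simp only [hu]
      exact hasSum_inner_fockKernel hβ hθ z u
    · simp only [mul_div_cancel_right₀ _ (hg _)]
      exact lp.memℓp u

/-! ### Laguerre series -/

/-- The limit in `L²` and the pointwise sum of a Laguerre series agree almost everywhere. -/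
lemma ae_eq_of_hasSum_laguerre {ν : ℝ} (hν : -1 < ν) {c : ℕ → ℂ}
    {g : Lp ℂ 2 (laguerreMeasure ν)} {f : ℝ → ℂ}
    (hg : HasSum (fun k => c k • laguerreLp hν k) g)
    (hf : ∀ x : ℝ, HasSum (fun k => c k * (laguerreON ν k x : ℂ)) (f x)) :
    g =ᵐ[laguerreMeasure ν] f := by
  obtain ⟨ns, hns, hae⟩ :=
    (tendstoInMeasure_of_tendsto_Lp hg.tendsto_sum_nat).exists_seq_tendsto_ae
  have hpart : ∀ N : ℕ, ∀ᵐ x ∂laguerreMeasure ν,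
      (∑ k ∈ Finset.range N, c k • laguerreLp hν k : Lp ℂ 2 (laguerreMeasure ν)) x =
        ∑ k ∈ Finset.range N, c k * (laguerreON ν k x : ℂ) := by
    intro N
    have h1 : ∀ k : ℕ, ∀ᵐ x ∂laguerreMeasure ν,
        (c k • laguerreLp hν k : Lp ℂ 2 (laguerreMeasure ν)) x =
          c k * (laguerreON ν k x : ℂ) := by
      intro k
      filter_upwards [Lp.coeFn_smul (c k) (laguerreLp hν k), coeFn_laguerreLp hν k] with x hx1 hx2
      rw [hx1, Pi.smul_apply, hx2, smul_eq_mul]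
    filter_upwards [Lp.coeFn_fun_finsetSum (Finset.range N) fun k => c k • laguerreLp hν k,
      ae_all_iff.mpr h1] with x hx1 hx2
    rw [hx1]
    exact Finset.sum_congr rfl fun k _ => hx2 k
  filter_upwards [hae, ae_all_iff.mpr hpart] with x hx1 hx2
  simp only [hx2] at hx1
  exact tendsto_nhds_unique hx1 ((hf x).tendsto_sum_nat.comp hns.tendsto_atTop)

/-- The Meixner basis turns a vector of `ℓ²` into the Laguerre series of the entire function which
it represents. -/
lemma hasSum_inner_mul_laguerreON {ν θ : ℝ} (hβ : 0 < ν + 1) (hθ : 1 < θ)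
    {b : HilbertBasis ℕ ℂ ℓ²(ℕ, ℂ)} (hb : ∀ k n, b k n = meixnerMatrix (ν + 1) θ n k)
    (u : ℓ²(ℕ, ℂ)) (x : ℝ) :
    HasSum (fun k => ((1 - θ⁻¹) ^ ((ν + 1) / 2) * √(θ ^ k)⁻¹ : ℝ) * b.repr u k *
        (laguerreON ν k x : ℂ))
      (Complex.exp (-(x / (θ - 1))) * ⟪fockKernel hβ hθ x, u⟫_ℂ) := by
  have h := ((b.hasSum_repr u).mapL (innerSL ℂ (fockKernel hβ hθ x))).mul_left
    (Complex.exp (-(x / (θ - 1))))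
  refine h.of_eq (fun k => ?_) rfl
  rw [innerSL_apply_apply, inner_smul_right, inner_fockKernel_eq_laguerreON hβ hθ (hb k)]
  have hexp : Complex.exp (-(x / (θ - 1))) * Complex.exp (x / (θ - 1)) = 1 := by
    rw [← Complex.exp_add, neg_add_cancel, Complex.exp_zero]
  rw [Complex.ofReal_mul _ (laguerreON ν k x)]
  generalize Complex.exp (-(x / (θ - 1))) = E at *
  generalize Complex.exp (x / (θ - 1)) = E' at *
  generalize (((1 - θ⁻¹) ^ ((ν + 1) / 2) * √(θ ^ k)⁻¹ : ℝ) : ℂ) = d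
  linear_combination (-(d * b.repr u k * laguerreON ν k x)) * hexp

theorem mainTheorem4 (ν θ : ℝ) (hν : -1 < ν) (hθ : 1 < θ) (f : ℝ → ℂ) :
    (MemLp f 2 (laguerreMeasure ν) ∧
        Summable fun k : ℕ => ‖laguerreCoeff ν f k‖ ^ 2 * θ ^ k) ↔
      ∃ F : ℂ → ℂ, Differentiable ℂ F ∧
        (∀ᵐ x ∂(volume.restrict (Ioi (0 : ℝ))), f x = F (x : ℂ)) ∧
        Integrable (fun z : ℂ =>
          ‖F z‖ ^ 2 * Real.exp (2 * z.re / (θ - 1)) * ‖z‖ ^ ν *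
            macdonaldK ν (2 * Real.sqrt θ * ‖z‖ / (θ - 1))) volume := by
  have hβ : 0 < ν + 1 := by linarith
  have hθ0 : 0 < θ := by positivity
  obtain ⟨b, hb⟩ := exists_hilbertBasis_meixnerMatrix hβ hθ
  obtain ⟨e, he⟩ := exists_hilbertBasis_laguerreLp hν
  -- the factor relating the Laguerre coefficients to the coordinates in the Meixner basis
  set D : ℕ → ℝ := fun k => (1 - θ⁻¹) ^ ((ν + 1) / 2) * √(θ ^ k)⁻¹ with hD
  have hq1 : 0 < 1 - θ⁻¹ := sub_pos.mpr (inv_lt_one_of_one_lt₀ hθ)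
  have hDpos : ∀ k, 0 < D k := fun k => by
    rw [hD]
    positivity
  have hDsq : ∀ k, D k ^ 2 * θ ^ k = (1 - θ⁻¹) ^ (ν + 1) := by
    intro k
    rw [hD]
    simp only
    rw [mul_pow, Real.sq_sqrt (by positivity), ← Real.rpow_natCast, ← Real.rpow_mul hq1.le,
      mul_assoc, inv_mul_cancel₀ (by positivity)]
    push_cast
    rw [div_mul_cancel₀ _ two_ne_zero, mul_one]
  constructor
  · rintro ⟨hf, hsum⟩
    -- the vector of `ℓ²` with coordinates `f_k / D k` represents the entire extension of `f`
    set g := hf.toLp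
    have hgf : g =ᵐ[laguerreMeasure ν] f := hf.coeFn_toLp
    have hmem : Memℓp (fun k => laguerreCoeff ν f k / (D k : ℂ)) 2 := by
      rw [memℓp_two_iff]
      refine (hsum.mul_left ((1 - θ⁻¹) ^ (ν + 1))⁻¹).congr fun k => ?_
      have := (hDpos k).ne'
      rw [norm_div, Complex.norm_of_nonneg (hDpos k).le, div_pow, ← hDsq k]
      field_simp
    set u : ℓ²(ℕ, ℂ) := b.repr.symm ⟨_, hmem⟩ with hu
    have hser : ∀ x : ℝ, HasSum (fun k => laguerreCoeff ν f k * (laguerreON ν k x : ℂ))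
        (Complex.exp (-(x / (θ - 1))) * ⟪fockKernel hβ hθ x, u⟫_ℂ) := by
      intro x
      refine (hasSum_inner_mul_laguerreON hβ hθ hb u x).of_eq (fun k => ?_) rfl
      have hDk : (D k : ℂ) ≠ 0 := by exact_mod_cast (hDpos k).ne'
      rw [hu, LinearIsometryEquiv.apply_symm_apply]
      change _ = (D k : ℂ) * (laguerreCoeff ν f k / (D k : ℂ)) * _
      rw [mul_div_cancel₀ _ hDk]
    have hgsum : HasSum (fun k => laguerreCoeff ν f k • laguerreLp hν k) g :=
      (e.hasSum_repr g).of_eq (fun k => by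
        rw [e.repr_apply_apply, he, inner_laguerreLp_eq_laguerreCoeff hν k hgf]) rfl
    have hae := ae_eq_of_hasSum_laguerre hν hgsum hser
    have hdiff := differentiable_inner_fockKernel hβ hθ u
    have hFd : Differentiable ℂ fun z : ℂ =>
        Complex.exp (-(z / (θ - 1))) * ⟪fockKernel hβ hθ z, u⟫_ℂ := by fun_prop
    refine ⟨_, hFd, ?_, (integrable_iff_exists_inner_fockKernel hβ hθ hFd).mpr ⟨u, fun z => ?_⟩⟩
    · refine (ae_laguerreMeasure_iff (ν := ν)).mp ?_
      filter_upwards [hgf, hae] with x h1 h2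
      rw [← h1, h2]
    · rw [← mul_assoc, ← Complex.exp_add, add_neg_cancel, Complex.exp_zero, one_mul]
  · rintro ⟨F, hFd, hfF, hint⟩
    obtain ⟨u, hu⟩ := (integrable_iff_exists_inner_fockKernel hβ hθ hFd).mp hint
    have hFu : ∀ z : ℂ, Complex.exp (-(z / (θ - 1))) * ⟪fockKernel hβ hθ z, u⟫_ℂ = F z := by
      intro z
      rw [← hu, ← mul_assoc, ← Complex.exp_add, neg_add_cancel, Complex.exp_zero, one_mul]
    have husum : Summable fun k => ‖b.repr u k‖ ^ 2 := memℓp_two_iff.mp (lp.memℓp (b.repr u))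
    have hsq : ∀ k, ‖(D k : ℂ) * b.repr u k‖ ^ 2 * θ ^ k =
        (1 - θ⁻¹) ^ (ν + 1) * ‖b.repr u k‖ ^ 2 := by
      intro k
      rw [norm_mul, Complex.norm_of_nonneg (hDpos k).le, mul_pow, ← hDsq k]
      ring
    have hsum : Summable fun k => ‖(D k : ℂ) * b.repr u k‖ ^ 2 * θ ^ k := by
      simp only [hsq]
      exact husum.mul_left _
    have hmem : Memℓp (fun k => (D k : ℂ) * b.repr u k) 2 := by
      rw [memℓp_two_iff]
      refine hsum.of_nonneg_of_le (fun k => by positivity) fun k => ?_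
      exact le_mul_of_one_le_right (by positivity) (one_le_pow₀ hθ.le)
    -- the coordinates of `F` in the Meixner basis, rescaled, are the Laguerre coefficients of `f`
    set g := e.repr.symm ⟨_, hmem⟩ with hg
    have hgsum : HasSum (fun k => ((D k : ℂ) * b.repr u k) • laguerreLp hν k) g :=
      (e.hasSum_repr_symm ⟨_, hmem⟩).of_eq (fun k => by rw [he]) rfl
    have hae := ae_eq_of_hasSum_laguerre hν hgsum fun x => by
      have h := hasSum_inner_mul_laguerreON hβ hθ hb u x
      rwa [hFu] at h
    have hgf : g =ᵐ[laguerreMeasure ν] f := by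
      filter_upwards [hae, ae_laguerreMeasure_iff.mpr hfF] with x h1 h2
      rw [h1, h2]
    refine ⟨(Lp.memLp g).ae_eq hgf, hsum.congr fun k => ?_⟩
    rw [← inner_laguerreLp_eq_laguerreCoeff hν k hgf, ← he, ← e.repr_apply_apply, hg,
      LinearIsometryEquiv.apply_symm_apply]
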